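/- Let $s=xy+1$, $p=xs+1$, $u=s^2+y$ in $\mathbb{C}[x,y]$, let $$g'=p^2u-\tfrac{7}{9}ps+\tfrac19 s,$$ a polynomial of degree $10$, and let $b'=-\tfrac{64}{81}$. For $t\in\mathbb{C}$ let $C'_t\subset\mathbb{P}^2$ be the projective closure of the affine curve $g'(x,y)=t$, given by the homogenization $f'_t\in S=\mathbb{C}[x,y,z]$ of $g'-t$. For a reduced plane curve $C:f=0$ of degree $d$, let $D_0(f)=\{(a,b,c)\in S^3 : af_x+bf_y+cf_z=0\}$. The curve $C$ is an $m$-syzygy curve with exponents $(d_1,\dots,d_m)$, $d_1\le\dots\le d_m$, if the graded $S$-module $D_0(f)$ is minimally generated by $m$ homogeneous syzygies of degrees $d_1,\dots,d_m$. It is a minimal plus-one generated (MPOG) curve with exponents $(d_1,d_2,d_3)$ if it is a 3-syzygy curve with these exponents, $d_1+d_2=d$ and $d_3=d_2+1$. It is nearly free with exponents $(d_1,d_2)$ if it is a 3-syzygy curve with exponents $(d_1,d_2,d_2)$ and $d_1+d_2=d$. The total Tjurina number $\tau(C)$ is the degree of the Jacobian ideal $J_f=(f_x,f_y,f_z)$,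 that is, the value of $\dim_{\mathbb{C}}(S/J_f)_k$ for all large $k$. Then $C'_1$, $C'_0$ and $C'_{b'}$ are irreducible reduced curves of degree $10$, and their geometric genera (the dimension of the space of regular differentials on the smooth projective model) are $$g(C'_1)=1,\qquad g(C'_0)=g(C'_{b'})=0.$$ Moreover: 1. $C'_1$ is an MPOG curve with exponents $(5,5,6)$, and $\tau(C'_1)=59$. 2. $C'_0$ and $C'_{b'}$ are nearly free curves with exponents $(5,5)$, and $\tau(C'_0)=\tau(C'_{b'})=60$. -/

import Mathlib

open scoped KaehlerDifferential

namespace PlaneCurve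

/-! ### The affine polynomial and the projective closures of its fibers -/

/-- The homogenization of `p(x, y)` with respect to the new variable `z = X 2`, i.e.
`z ^ deg p * p(x / z, y / z)`: an equation of the projective closure in `ℙ²` of the affine curve
`p = 0`. -/
noncomputable def homogenize (p : MvPolynomial (Fin 2) ℂ) : MvPolynomial (Fin 3) ℂ :=
  ∑ m ∈ p.support,
    MvPolynomial.C (p.coeff m) * MvPolynomial.X 0 ^ m 0 * MvPolynomial.X 1 ^ m 1 *
      MvPolynomial.X 2 ^ (p.totalDegree - (m 0 + m 1))

/-- `s = x y + 1`. -/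
noncomputable def s : MvPolynomial (Fin 2) ℂ := MvPolynomial.X 0 * MvPolynomial.X 1 + 1

/-- `p = x s + 1`. -/
noncomputable def p : MvPolynomial (Fin 2) ℂ := MvPolynomial.X 0 * s + 1

/-- `u = s ^ 2 + y`. -/
noncomputable def u : MvPolynomial (Fin 2) ℂ := s ^ 2 + MvPolynomial.X 1

/-- The Briançon-type polynomial `g' = p² u - (7/9) p s + (1/9) s`. -/
noncomputable def g' : MvPolynomial (Fin 2) ℂ :=
  p ^ 2 * u - MvPolynomial.C (7 / 9) * p * s + MvPolynomial.C (1 / 9) * s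

/-- The atypical value `b' = -64/81` of `g'`. -/
noncomputable def b' : ℂ := -64 / 81

/-- The homogeneous equation of `C'_t`, the projective closure of the fiber `g' = t`. -/
noncomputable def C' (t : ℂ) : MvPolynomial (Fin 3) ℂ := homogenize (g' - MvPolynomial.C t)

/-! ### The geometric genus -/

/-- The regular differentials of a function field `K / k`: those `ω ∈ Ω[K⁄k]` that are regular at
every place, i.e. which for every valuation ring `k ⊆ A ⊆ K` lie in the image of `Ω[A⁄k]`,
that is, are finite sums of terms `a db` with `a, b ∈ A`. For `K` of transcendence degree one over
an algebraically closed field `k` the valuation rings `A ≠ K` are the local rings of the smooth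
projective model `X` of `K`, and this is `H⁰(X, Ω¹)`. -/
noncomputable def regularDifferentials (k K : Type) [Field k] [Field K] [Algebra k K] :
    Submodule k Ω[K⁄k] :=
  ⨅ (A : ValuationSubring K) (_ : ∀ c : k, algebraMap k K c ∈ A),
    Submodule.span k {η | ∃ a ∈ A, ∃ b ∈ A, η = a • KaehlerDifferential.D k K b}

/-- The function field of the irreducible plane curve `f = 0`: the quotients `a / b` of (classes
of) homogeneous forms of the same degree, inside the fraction field of `ℂ[x, y, z] / (f)`. -/
noncomputable def functionField (f : MvPolynomial (Fin 3) ℂ) [(Ideal.span {f}).IsPrime] :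
    IntermediateField ℂ (FractionRing (MvPolynomial (Fin 3) ℂ ⧸ Ideal.span {f})) :=
  IntermediateField.adjoin ℂ
    {q | ∃ (n : ℕ) (a b : MvPolynomial (Fin 3) ℂ), a.IsHomogeneous n ∧ b.IsHomogeneous n ∧
      b ∉ Ideal.span {f} ∧
      q = algebraMap (MvPolynomial (Fin 3) ℂ ⧸ Ideal.span {f}) _ (Ideal.Quotient.mk _ a) /
          algebraMap (MvPolynomial (Fin 3) ℂ ⧸ Ideal.span {f}) _ (Ideal.Quotient.mk _ b)}

/-- `f = 0` is an irreducible plane curve of geometric genus `n`: the regular differentials of its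
function field form a complex vector space of dimension `n`. (The dimension is taken as a
cardinal, so that infinite dimension is not confused with dimension `0`.) -/
def HasGeometricGenus (f : MvPolynomial (Fin 3) ℂ) (n : ℕ) : Prop :=
  ∃ _ : (Ideal.span {f}).IsPrime,
    Module.rank ℂ (regularDifferentials ℂ (functionField f)) = (n : Cardinal)

/-! ### Jacobian syzygies, exponents, total Tjurina number -/

/-- `f = 0` is a reduced plane curve of degree `d`. -/
def IsReducedCurve (f : MvPolynomial (Fin 3) ℂ) (d : ℕ) : Prop :=
  f.IsHomogeneous d ∧ Squarefree f

/-- `D₀(f)`, the module of triples `(a, b, c)` with `a f_x + b f_y + c f_z = 0`. -/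
noncomputable def jacobianSyzygies (f : MvPolynomial (Fin 3) ℂ) :
    Submodule (MvPolynomial (Fin 3) ℂ) (Fin 3 → MvPolynomial (Fin 3) ℂ) :=
  LinearMap.ker
    (Fintype.linearCombination (MvPolynomial (Fin 3) ℂ) fun i => MvPolynomial.pderiv i f)

/-- `f = 0` is an `m`-syzygy curve with exponents `d 0 ≤ d 1 ≤ …`: the module `D₀(f)` is minimally
generated by `m` homogeneous syzygies `ρ j` of degrees `d j`. -/
def HasExponents (f : MvPolynomial (Fin 3) ℂ) {m : ℕ} (d : Fin m → ℕ) : Prop :=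
  Monotone d ∧
    ∃ ρ : Fin m → Fin 3 → MvPolynomial (Fin 3) ℂ,
      (∀ j i, (ρ j i).IsHomogeneous (d j)) ∧
      Submodule.span (MvPolynomial (Fin 3) ℂ) (Set.range ρ) = jacobianSyzygies f ∧
      ∀ j, ρ j ∉ Submodule.span (MvPolynomial (Fin 3) ℂ) (ρ '' {i | i ≠ j})

/-- `f = 0` is a plus-one generated curve of degree `d` with exponents `(d₁, d₂, d₃)`: a 3-syzygy
curve such that `d₁ + d₂ = d`. -/
def IsPlusOneGenerated (f : MvPolynomial (Fin 3) ℂ) (d d₁ d₂ d₃ : ℕ) : Prop :=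
  IsReducedCurve f d ∧ HasExponents f ![d₁, d₂, d₃] ∧ d₁ + d₂ = d

/-- A minimal plus-one generated curve: plus-one generated with `d₃ - d₂ = 1`. -/
def IsMPOG (f : MvPolynomial (Fin 3) ℂ) (d d₁ d₂ d₃ : ℕ) : Prop :=
  IsPlusOneGenerated f d d₁ d₂ d₃ ∧ d₃ = d₂ + 1

/-- A nearly free curve with exponents `(d₁, d₂)`: a 3-syzygy curve with exponents `(d₁, d₂, d₂)`
such that `d₁ + d₂ = d`. -/
def IsNearlyFree (f : MvPolynomial (Fin 3) ℂ) (d d₁ d₂ : ℕ) : Prop :=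
  IsPlusOneGenerated f d d₁ d₂ d₂

/-- The Jacobian ideal `J_f`, generated by the partial derivatives of `f`. -/
noncomputable def jacobianIdeal (f : MvPolynomial (Fin 3) ℂ) : Ideal (MvPolynomial (Fin 3) ℂ) :=
  Ideal.span (Set.range fun i => MvPolynomial.pderiv i f)

/-- `M(f)_k`, the degree `k` component of the Milnor algebra `M(f) = ℂ[x, y, z] / J_f`. -/
noncomputable def milnorAlgebraPart (f : MvPolynomial (Fin 3) ℂ) (k : ℕ) :
    Submodule ℂ (MvPolynomial (Fin 3) ℂ ⧸ jacobianIdeal f) :=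
  (MvPolynomial.homogeneousSubmodule (Fin 3) ℂ k).map
    (Ideal.Quotient.mkₐ ℂ (jacobianIdeal f)).toLinearMap

/-- The total Tjurina number of `f = 0` is `τ`. It is the degree of the Jacobian ideal, i.e. of the
zero-dimensional subscheme of `ℙ²` that `J_f` defines: the Hilbert function `k ↦ dim M(f)_k` is
eventually constant, with value `τ`. -/
def HasTotalTjurinaNumber (f : MvPolynomial (Fin 3) ℂ) (τ : ℕ) : Prop :=
  ∀ᶠ k in Filter.atTop, Module.finrank ℂ (milnorAlgebraPart f k) = τ

end PlaneCurve

namespace PlaneCurve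
open MvPolynomial

/-! ### Jacobian syzygies from a Hilbert–Burch type resolution -/

/-! Two independent computations, syzygies and function fields, give the result. Both use that the
fibers are irreducible, which also makes them reduced.

Syzygies. Each fiber has three explicit syzygies `ρ 0`, `ρ 1`, `ρ 2` with one relation ∑ `h j` `ρ j`
= 0, where `h 2`, `h 1`, `h 0` is a regular sequence and the cross product ρ₀ × ρ₁ is a nonzero
constant times h₂ ∇f. As in the Hilbert–Burch theorem, this yields a free resolution 0 → S → S³ → S³
→ S of the Milnor algebra (`IsHilbertBurch.exists_eq_sum`, `IsHilbertBurch.eq_mul_of_sum_eq_zero`).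
The entries of h have no constant term, so the generators are minimal
(`IsHilbertBurch.hasExponents`), and an alternating sum of binomials gives the Hilbert function
(`IsHilbertBurch.finrank_milnorAlgebraPart`), hence τ. Over 0 and b' the relation is (x, y, z) on
generators of degrees 5, 5, 5; over 1 it has entries of degrees 2, 2, 1 on generators of degrees 5,
5, 6.

Irreducibility and genus. Put P = p and S = s. Then x = (P - 1)/S and y = S(S - 1)/(P - 1), so (P,
S) are birational coordinates, and 9xs(g' - t) = 9P³S² - (4P - 1)²S - 9t(P - 1). This quadratic in S
has discriminant (4P - 1)⁴ + 324tP³(P - 1). Over t = 1 it is a separable quartic. Over b', where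
324b' = -256, the terms of degrees 4 and 3 cancel and a separable quadratic remains. Over t = 0 it
is a square, a factor S splits off, and P parametrizes the curve. On w² = q(p) with q squarefree,
dp/w generates the differentials at every place where p is finite
(`IsHyperelliptic.derivation_mem_valuationSubring`), so a regular differential is f dp/w with f
regular there. The chart (1/p, w/pⁿ) at infinity shows that f is a constant, which must vanish if n
< 2 and is arbitrary if n = 2. The three curves have n = 2 (t = 1), n = 1 (b') and n = 0 (t = 0). -/

/-- Ternary polynomials. -/
abbrev Form := MvPolynomial (Fin 3) ℂ

theorem homogeneousComponent_mul_of_isHomogeneous {a b : Form} {d n : ℕ} (hb : b.IsHomogeneous d)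
    (h : d ≤ n) : homogeneousComponent n (a * b) = homogeneousComponent (n - d) a * b := by
  let _ := MvPolynomial.gradedAlgebra (σ := Fin 3) (R := ℂ)
  have := DirectSum.coe_decompose_mul_of_right_mem_of_le (homogeneousSubmodule (Fin 3) ℂ) (a := a)
    ((mem_homogeneousSubmodule d b).2 hb) h
  have e : ∀ (m : ℕ) (q : Form),
      ((DirectSum.decompose (homogeneousSubmodule (Fin 3) ℂ) q m : homogeneousSubmodule (Fin 3) ℂ m) : Form)
        = homogeneousComponent m q := fun m q => decomposition.decompose'_apply q m
  rwa [e, e] at this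

/-- A vector field parallel to the gradient of a prime form is a polynomial multiple of it. -/
theorem exists_eq_mul_pderiv {f : Form} {d : ℕ} (hp : Prime f) (hf : f.IsHomogeneous d)
    (h0 : pderiv 0 f ≠ 0) {v₀ v₁ v₂ : Form} (h01 : v₀ * pderiv 1 f = v₁ * pderiv 0 f)
    (h02 : v₀ * pderiv 2 f = v₂ * pderiv 0 f) (h12 : v₁ * pderiv 2 f = v₂ * pderiv 1 f) :
    ∃ m, v₀ = m * pderiv 0 f ∧ v₁ = m * pderiv 1 f ∧ v₂ = m * pderiv 2 f := by
  have hd : d ≠ 0 := by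
    rintro rfl
    apply h0
    have := (totalDegree_zero_iff_isHomogeneous _).2 hf
    rw [totalDegree_eq_zero_iff_eq_C] at this
    rw [this, pderiv_C]
  have euler := hf.sum_X_mul_pderiv
  rw [Fin.sum_univ_three, nsmul_eq_mul] at euler
  -- The vector v is parallel to ∇f, so Euler's identity turns its pairing E with (x, y, z) into E
  -- ∇f = d f v. The prime f does not divide f_x, which has smaller degree; hence f divides E, and v
  -- = (E / (d f)) ∇f.
  set E : Form := X 0 * v₀ + X 1 * v₁ + X 2 * v₂ with hEdef
  have hE0 : E * pderiv 0 f = v₀ * ((d : Form) * f) := by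
    rw [← euler]
    linear_combination -(X 1) * h01 - (X 2) * h02
  have hE1 : E * pderiv 1 f = v₁ * ((d : Form) * f) := by
    rw [← euler]
    linear_combination (X 0) * h01 - (X 2) * h12
  have hE2 : E * pderiv 2 f = v₂ * ((d : Form) * f) := by
    rw [← euler]
    linear_combination (X 0) * h02 + (X 1) * h12
  have hnd : ¬ f ∣ pderiv 0 f := by
    rintro ⟨q, hq⟩
    have hq0 : q ≠ 0 := by rintro rfl; simp at hq; exact h0 hq
    have h1 : (pderiv 0 f).totalDegree = f.totalDegree + q.totalDegree := by
      rw [hq, totalDegree_mul_of_isDomain hp.ne_zero hq0]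
    have h2 : (pderiv 0 f).totalDegree ≤ d - 1 := (hf.pderiv (i := 0)).totalDegree_le
    rw [hf.totalDegree hp.ne_zero] at h1
    omega
  obtain ⟨m, hm⟩ : f ∣ E := by
    have : f ∣ E * pderiv 0 f := ⟨v₀ * d, by rw [hE0]; ring⟩
    exact (hp.dvd_or_dvd this).resolve_right hnd
  have hdC : (C ((d : ℂ)⁻¹) : Form) * d = 1 := by
    rw [← map_natCast (C : ℂ →+* Form), ← C_mul, inv_mul_cancel₀ (by exact_mod_cast hd), C_1]
  have key : ∀ v g : Form, E * g = v * ((d : Form) * f) → v = C ((d : ℂ)⁻¹) * m * g := by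
    intro v g hv
    rw [hm] at hv
    apply mul_left_cancel₀ hp.ne_zero
    linear_combination (-C ((d : ℂ)⁻¹)) * hv - v * f * hdC
  exact ⟨C ((d : ℂ)⁻¹) * m, key _ _ hE0, key _ _ hE1, key _ _ hE2⟩

/-- Data of a free resolution `0 → S → S³ → S³ → S` of the Milnor algebra of `f`. -/
structure IsHilbertBurch (f : Form) (ρ : Fin 3 → Fin 3 → Form) (h : Fin 3 → Form) : Prop where
  rel : ∀ i, h 0 * ρ 0 i + h 1 * ρ 1 i + h 2 * ρ 2 i = 0
  cross : ∃ κ : ℂ, κ ≠ 0 ∧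
    ρ 0 1 * ρ 1 2 - ρ 0 2 * ρ 1 1 = C κ * h 2 * pderiv 0 f ∧
    ρ 0 2 * ρ 1 0 - ρ 0 0 * ρ 1 2 = C κ * h 2 * pderiv 1 f ∧
    ρ 0 0 * ρ 1 1 - ρ 0 1 * ρ 1 0 = C κ * h 2 * pderiv 2 f
  ne_zero : h 2 ≠ 0
  regular_one : ∀ a, h 2 ∣ a * h 1 → h 2 ∣ a
  regular_zero : ∀ a b, h 2 ∣ a * h 0 + b * h 1 → ∃ c, h 2 ∣ a - c * h 1

theorem mem_jacobianSyzygies {f : Form} {v : Fin 3 → Form} :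
    v ∈ jacobianSyzygies f ↔
      v 0 * pderiv 0 f + v 1 * pderiv 1 f + v 2 * pderiv 2 f = 0 := by
  rw [jacobianSyzygies, LinearMap.mem_ker, Fintype.linearCombination_apply, Fin.sum_univ_three]
  simp

namespace IsHilbertBurch
variable {f : Form} {ρ : Fin 3 → Fin 3 → Form} {h : Fin 3 → Form}

/-- The fields `regular_one` and `regular_zero` say that h₁ is a nonzerodivisor modulo h₂ and h₀ one
modulo (h₂, h₁). The Koszul complex is then exact in the middle: every relation among the h_j is a
combination of the trivial ones. -/
theorem koszul (H : IsHilbertBurch f ρ h) {m : Fin 3 → Form}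
    (hm : m 0 * h 0 + m 1 * h 1 + m 2 * h 2 = 0) :
    ∃ c d e, m 0 = c * h 1 + h 2 * d ∧ m 1 = -c * h 0 + h 2 * e ∧ m 2 = -(d * h 0 + e * h 1) := by
  obtain ⟨c, d, hd⟩ := H.regular_zero (m 0) (m 1) ⟨-m 2, by linear_combination hm⟩
  obtain ⟨e, he⟩ := H.regular_one (m 1 + c * h 0) ⟨-m 2 - d * h 0, by
    linear_combination hm - (h 0) * hd⟩
  refine ⟨c, d, e, by linear_combination hd, by linear_combination he, ?_⟩
  apply mul_left_cancel₀ H.ne_zero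
  linear_combination hm - (h 0) * hd - h 1 * he

/-- ρ₀ and ρ₁ are orthogonal to ρ₀ × ρ₁, a nonzero multiple of ∇f; the relation transfers this to ρ₂
because h₂ ≠ 0. -/
theorem mem_of_first (H : IsHilbertBurch f ρ h) (j : Fin 3) : ρ j ∈ jacobianSyzygies f := by
  obtain ⟨κ, hκ, c0, c1, c2⟩ := H.cross
  have hC : (C κ : Form) ≠ 0 := by simpa using hκ
  have hn := mul_ne_zero hC H.ne_zero
  have r0 : ρ 0 ∈ jacobianSyzygies f := by
    rw [mem_jacobianSyzygies]
    apply mul_left_cancel₀ hn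
    linear_combination (-ρ 0 0) * c0 - ρ 0 1 * c1 - ρ 0 2 * c2
  have r1 : ρ 1 ∈ jacobianSyzygies f := by
    rw [mem_jacobianSyzygies]
    apply mul_left_cancel₀ hn
    linear_combination (-ρ 1 0) * c0 - ρ 1 1 * c1 - ρ 1 2 * c2
  fin_cases j
  · exact r0
  · exact r1
  · rw [mem_jacobianSyzygies] at r0 r1 ⊢
    apply mul_left_cancel₀ H.ne_zero
    simp only [Fin.reduceFinMk]
    linear_combination pderiv 0 f * H.rel 0 + pderiv 1 f * H.rel 1 + pderiv 2 f * H.rel 2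
      - h 0 * r0 - h 1 * r1

/-- Exactness at the second module. The matrix of ρ has rank two, so c is proportional to h, i.e.
c_j h₂ = c₂ h_j. Since h₂ divides c₂ h₁, it divides c₂ by `regular_one`, and the quotient is the
factor. -/
theorem eq_mul_of_sum_eq_zero (H : IsHilbertBurch f ρ h) (h0 : pderiv 0 f ≠ 0) {c : Fin 3 → Form}
    (hc : ∀ i, c 0 * ρ 0 i + c 1 * ρ 1 i + c 2 * ρ 2 i = 0) : ∃ q, ∀ j, c j = q * h j := by
  obtain ⟨κ, hκ, c0, c1, c2⟩ := H.cross
  have hC : (C κ : Form) ≠ 0 := by simpa using hκ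
  have hn := mul_ne_zero (mul_ne_zero hC H.ne_zero) h0
  have e1 : c 1 * h 2 = c 2 * h 1 := by
    apply mul_left_cancel₀ hn
    linear_combination (c 2 * h 1 - c 1 * h 2) * c0
      + ρ 0 1 * h 2 * hc 2 - ρ 0 2 * h 2 * hc 1 - ρ 0 1 * c 2 * H.rel 2 + ρ 0 2 * c 2 * H.rel 1
  have e0 : c 0 * h 2 = c 2 * h 0 := by
    apply mul_left_cancel₀ hn
    linear_combination (c 2 * h 0 - c 0 * h 2) * c0
      - ρ 1 1 * h 2 * hc 2 + ρ 1 2 * h 2 * hc 1 + ρ 1 1 * c 2 * H.rel 2 - ρ 1 2 * c 2 * H.rel 1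
  obtain ⟨q, hq⟩ := H.regular_one (c 2) ⟨c 1, by linear_combination -e1⟩
  refine ⟨q, fun j => ?_⟩
  fin_cases j <;> simp only [Fin.mk_zero, Fin.mk_one, Fin.reduceFinMk]
  · apply mul_left_cancel₀ H.ne_zero
    linear_combination e0 + h 0 * hq
  · apply mul_left_cancel₀ H.ne_zero
    linear_combination e1 + h 1 * hq
  · linear_combination hq

/-- Exactness at the third module. Both v and ρ_j are orthogonal to ∇f, so v × ρ_j = m_j ∇f with m_j
polynomial, f being prime. The relation between the ρ_j forces ∑ m_j h_j = 0, and the Koszul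
coefficients of m are, up to κ, the coefficients of v in the ρ_j. -/
theorem exists_eq_sum (H : IsHilbertBurch f ρ h) {d : ℕ} (hp : Prime f) (hf : f.IsHomogeneous d)
    (h0 : pderiv 0 f ≠ 0) {v : Fin 3 → Form} (hv : v ∈ jacobianSyzygies f) :
    ∃ c : Fin 3 → Form, ∀ i, v i = c 0 * ρ 0 i + c 1 * ρ 1 i + c 2 * ρ 2 i := by
  rw [mem_jacobianSyzygies] at hv
  have hm : ∀ j, ∃ m, v 1 * ρ j 2 - v 2 * ρ j 1 = m * pderiv 0 f ∧
      v 2 * ρ j 0 - v 0 * ρ j 2 = m * pderiv 1 f ∧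
      v 0 * ρ j 1 - v 1 * ρ j 0 = m * pderiv 2 f := by
    intro j
    have hr := mem_jacobianSyzygies.1 (H.mem_of_first j)
    apply exists_eq_mul_pderiv hp hf h0
    · linear_combination ρ j 2 * hv - v 2 * hr
    · linear_combination -ρ j 1 * hv + v 1 * hr
    · linear_combination ρ j 0 * hv - v 0 * hr
  choose m m0 m1 m2 using hm
  obtain ⟨κ, hκ, c0, c1, c2⟩ := H.cross
  have hC : (C κ : Form) ≠ 0 := by simpa using hκ
  have hrel : m 0 * h 0 + m 1 * h 1 + m 2 * h 2 = 0 := by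
    apply mul_left_cancel₀ h0
    linear_combination -h 0 * m0 0 - h 1 * m0 1 - h 2 * m0 2 + v 1 * H.rel 2 - v 2 * H.rel 1
  obtain ⟨c, d', e, k0, k1, k2⟩ := H.koszul hrel
  have hκC : C κ⁻¹ * C κ = (1 : Form) := by rw [← C_mul, inv_mul_cancel₀ hκ, C_1]
  -- From ρ₀ × ρ₁ = κ h₂ ∇f and the relation, ρ₂ × ρ₀ = κ h₁ ∇f and ρ₁ × ρ₂ = κ h₀ ∇f. The
  -- subtracted combination therefore has the same cross products with ρ₀ and ρ₁ as v, so w is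
  -- parallel to two independent vectors and vanishes.
  set w : Fin 3 → Form := fun i => v i - C κ⁻¹ * (e * ρ 0 i - d' * ρ 1 i + c * ρ 2 i) with hw
  -- the cross products of `ρ 2` with `ρ 0` and `ρ 1`
  have x02 : ∀ i j, h 2 * (ρ 2 i * ρ 0 j - ρ 2 j * ρ 0 i) =
      h 1 * (ρ 0 i * ρ 1 j - ρ 0 j * ρ 1 i) := fun i j => by
    linear_combination ρ 0 j * H.rel i - ρ 0 i * H.rel j
  have x12 : ∀ i j, h 2 * (ρ 2 i * ρ 1 j - ρ 2 j * ρ 1 i) =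
      -h 0 * (ρ 0 i * ρ 1 j - ρ 0 j * ρ 1 i) := fun i j => by
    linear_combination ρ 1 j * H.rel i - ρ 1 i * H.rel j
  have w0 : ∀ i j t, ρ 0 i * ρ 1 j - ρ 0 j * ρ 1 i = C κ * h 2 * t →
      v i * ρ 0 j - v j * ρ 0 i = m 0 * t → w i * ρ 0 j = w j * ρ 0 i := by
    intro i j t ht hv0
    apply mul_left_cancel₀ H.ne_zero
    simp only [hw]
    linear_combination h 2 * hv0 - C κ⁻¹ * c * x02 i j - C κ⁻¹ * (c * h 1 + h 2 * d') * ht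
      + h 2 * t * k0 - h 2 * t * (c * h 1 + h 2 * d') * hκC
  have w1 : ∀ i j t, ρ 0 i * ρ 1 j - ρ 0 j * ρ 1 i = C κ * h 2 * t →
      v i * ρ 1 j - v j * ρ 1 i = m 1 * t → w i * ρ 1 j = w j * ρ 1 i := by
    intro i j t ht hv0
    apply mul_left_cancel₀ H.ne_zero
    simp only [hw]
    linear_combination h 2 * hv0 - C κ⁻¹ * c * x12 i j - C κ⁻¹ * (-c * h 0 + h 2 * e) * ht
      + h 2 * t * k1 - h 2 * t * (-c * h 0 + h 2 * e) * hκC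
  have a01 := w0 0 1 _ c2 (m2 0)
  have a12 := w0 1 2 _ c0 (m0 0)
  have a20 := w0 2 0 _ c1 (m1 0)
  have b01 := w1 0 1 _ c2 (m2 1)
  have b12 := w1 1 2 _ c0 (m0 1)
  have b20 := w1 2 0 _ c1 (m1 1)
  have hn := mul_ne_zero (mul_ne_zero hC H.ne_zero) h0
  have z0 : w 0 = 0 := by
    apply mul_left_cancel₀ hn
    linear_combination -w 0 * c0 + ρ 1 2 * a01 + ρ 1 1 * a20 + ρ 0 0 * b12
  have z1 : w 1 = 0 := by
    apply mul_left_cancel₀ hn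
    linear_combination -w 1 * c0 - ρ 1 1 * a12 + ρ 0 1 * b12
  have z2 : w 2 = 0 := by
    apply mul_left_cancel₀ hn
    linear_combination -w 2 * c0 - ρ 1 2 * a12 + ρ 0 2 * b12
  refine ⟨![C κ⁻¹ * e, -(C κ⁻¹ * d'), C κ⁻¹ * c], fun i => ?_⟩
  have : w i = 0 := by fin_cases i; exacts [z0, z1, z2]
  simp only [hw] at this
  simp only [Matrix.cons_val_zero, Matrix.cons_val_one, Matrix.cons_val]
  linear_combination this

theorem mem_span_image_iff_exists (s : Set (Fin 3)) (v : Fin 3 → Form)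
    (hv : v ∈ Submodule.span Form (ρ '' s)) :
    ∃ c : Fin 3 → Form, (∀ j, j ∉ s → c j = 0) ∧
      ∀ i, v i = c 0 * ρ 0 i + c 1 * ρ 1 i + c 2 * ρ 2 i := by
  induction hv using Submodule.span_induction with
  | mem x hx =>
    obtain ⟨j, hj, rfl⟩ := hx
    refine ⟨Pi.single j 1, fun k hk => Pi.single_eq_of_ne (by rintro rfl; exact hk hj) _,
      fun i => ?_⟩
    fin_cases j <;> simp
  | zero => exact ⟨0, by simp, by simp⟩
  | add x y _ _ hx hy =>
    obtain ⟨a, ha, ha'⟩ := hx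
    obtain ⟨b, hb, hb'⟩ := hy
    refine ⟨a + b, fun j hj => by simp [ha j hj, hb j hj], fun i => ?_⟩
    simp only [Pi.add_apply, ha', hb']
    ring
  | smul r x _ hx =>
    obtain ⟨a, ha, ha'⟩ := hx
    refine ⟨r • a, fun j hj => by simp [ha j hj], fun i => ?_⟩
    simp only [Pi.smul_apply, smul_eq_mul, ha']
    ring

theorem hasExponents (H : IsHilbertBurch f ρ h) {D : ℕ} (hp : Prime f) (hf : f.IsHomogeneous D)
    (h0 : pderiv 0 f ≠ 0) {d : Fin 3 → ℕ} (hd : Monotone d)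
    (hρ : ∀ j i, (ρ j i).IsHomogeneous (d j)) (hh : ∀ j, constantCoeff (h j) = 0) :
    HasExponents f d := by
  refine ⟨hd, ρ, hρ, le_antisymm ?_ ?_, fun j hj => ?_⟩
  · rw [Submodule.span_le]
    rintro _ ⟨j, rfl⟩
    exact H.mem_of_first j
  · intro v hv
    obtain ⟨c, hc⟩ := H.exists_eq_sum hp hf h0 hv
    have : v = c 0 • ρ 0 + c 1 • ρ 1 + c 2 • ρ 2 := by ext1 i; simp [hc]
    rw [this]
    exact add_mem (add_mem (Submodule.smul_mem _ _ (Submodule.subset_span ⟨0, rfl⟩))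
      (Submodule.smul_mem _ _ (Submodule.subset_span ⟨1, rfl⟩)))
      (Submodule.smul_mem _ _ (Submodule.subset_span ⟨2, rfl⟩))
  · obtain ⟨c, hc, hc'⟩ := mem_span_image_iff_exists _ _ hj
    have hcj : c j = 0 := hc j (by simp)
    -- Writing ρ_j through the other generators gives a relation with j-th entry -1. It would be a
    -- multiple of h, whose j-th entry has no constant term.
    obtain ⟨q, hq⟩ := H.eq_mul_of_sum_eq_zero h0 (c := c - Pi.single j 1) (fun i => by
      have := hc' i
      fin_cases j <;> simp at this ⊢ <;> linear_combination -this)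
    have h1 := congrArg constantCoeff (hq j)
    simp [hcj, hh] at h1

end IsHilbertBurch
end PlaneCurve

namespace PlaneCurve
open MvPolynomial

/-! ### The Hilbert function of the Milnor algebra -/

theorem finrank_homogeneousSubmodule (n : ℕ) :
    Module.finrank ℂ (homogeneousSubmodule (Fin 3) ℂ n) = (n + 2).choose 2 := by
  classical
  rw [homogeneousSubmodule_eq_finsupp_supported]
  have e : ({d : Fin 3 →₀ ℕ | d.degree = n} : Set (Fin 3 →₀ ℕ)) =
      ((Finset.univ : Finset (Fin 3)).finsuppAntidiag n : Set (Fin 3 →₀ ℕ)) := by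
    ext d
    simp [Finset.mem_finsuppAntidiag, Finsupp.degree_eq_sum]
  rw [e]
  refine (LinearEquiv.finrank_eq (AddMonoidAlgebra.supportedEquivFinsupp (R := ℂ) (S := ℂ) _)).trans ?_
  rw [Module.finrank_finsupp_self]
  refine (Fintype.card_coe _).trans ?_
  rw [Finset.card_finsuppAntidiag_nat_eq_choose]
  simp only [Finset.card_univ, Fintype.card_fin]
  rw [show 3 + n - 1 = n + 2 by omega, Nat.choose_symm_add]

instance (n : ℕ) : FiniteDimensional ℂ (homogeneousSubmodule (Fin 3) ℂ n) :=
  Module.Finite.iff_fg.2 (homogeneousSubmodule_fg (Fin 3) ℂ n)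

theorem finrank_map_add_finrank_inf_ker {V W : Type*} [AddCommGroup V] [Module ℂ V]
    [AddCommGroup W] [Module ℂ W] (φ : V →ₗ[ℂ] W) (U : Submodule ℂ V) [FiniteDimensional ℂ U] :
    Module.finrank ℂ (U.map φ) + Module.finrank ℂ (U ⊓ LinearMap.ker φ : Submodule ℂ V) =
      Module.finrank ℂ U := by
  rw [← (φ.domRestrict U).finrank_range_add_finrank_ker, LinearMap.range_domRestrict,
    LinearMap.ker_domRestrict]
  congr 1
  rw [← Submodule.map_comap_subtype]
  exact (Submodule.equivMapOfInjective _ U.subtype_injective _).finrank_eq.symm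

/-- The triples of forms of degrees `d 0, d 1, d 2`. -/
noncomputable def homogeneousTriples (d : Fin 3 → ℕ) : Submodule ℂ (Fin 3 → Form) :=
  Submodule.pi Set.univ fun j => homogeneousSubmodule (Fin 3) ℂ (d j)

theorem mem_homogeneousTriples {d : Fin 3 → ℕ} {v : Fin 3 → Form} :
    v ∈ homogeneousTriples d ↔ ∀ j, (v j).IsHomogeneous (d j) := by
  simp [homogeneousTriples, Submodule.mem_pi]

/-- Triples of forms as a product. -/
noncomputable def homogeneousTriplesEquiv (d : Fin 3 → ℕ) :
    homogeneousTriples d ≃ₗ[ℂ] ∀ j, homogeneousSubmodule (Fin 3) ℂ (d j) where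
  toFun v j := ⟨v.1 j, mem_homogeneousTriples.1 v.2 j⟩
  invFun v := ⟨fun j => (v j).1, mem_homogeneousTriples.2 fun j => (v j).2⟩
  map_add' _ _ := rfl
  map_smul' _ _ := rfl
  left_inv _ := rfl
  right_inv _ := rfl

instance (d : Fin 3 → ℕ) : FiniteDimensional ℂ (homogeneousTriples d) :=
  Module.Finite.equiv (homogeneousTriplesEquiv d).symm

theorem finrank_homogeneousTriples (d : Fin 3 → ℕ) :
    Module.finrank ℂ (homogeneousTriples d) = ∑ j, (d j + 2).choose 2 := by
  rw [(homogeneousTriplesEquiv d).finrank_eq, Module.finrank_pi_fintype]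
  simp [finrank_homogeneousSubmodule]

/-- `c ↦ ∑ c j • ρ j` as a map of complex vector spaces. -/
noncomputable def combine (ρ : Fin 3 → Fin 3 → Form) : (Fin 3 → Form) →ₗ[ℂ] (Fin 3 → Form) :=
  LinearMap.pi fun i => ∑ j, (LinearMap.mulRight ℂ (ρ j i)).comp (LinearMap.proj j)

theorem combine_apply (ρ : Fin 3 → Fin 3 → Form) (c : Fin 3 → Form) (i : Fin 3) :
    combine ρ c i = c 0 * ρ 0 i + c 1 * ρ 1 i + c 2 * ρ 2 i := by
  simp [combine, Fin.sum_univ_three]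

/-- `v ↦ ∑ v i * f_i` as a map of complex vector spaces. -/
noncomputable def gradientPairing (f : Form) : (Fin 3 → Form) →ₗ[ℂ] Form :=
  ∑ i, (LinearMap.mulRight ℂ (pderiv i f)).comp (LinearMap.proj i)

theorem gradientPairing_apply (f : Form) (v : Fin 3 → Form) :
    gradientPairing f v = v 0 * pderiv 0 f + v 1 * pderiv 1 f + v 2 * pderiv 2 f := by
  simp [gradientPairing, Fin.sum_univ_three]

/-- `q ↦ q • h` as a map of complex vector spaces. -/
noncomputable def scaleTriple (h : Fin 3 → Form) : Form →ₗ[ℂ] (Fin 3 → Form) :=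
  LinearMap.pi fun j => LinearMap.mulRight ℂ (h j)

theorem scaleTriple_apply (h : Fin 3 → Form) (q : Form) (j : Fin 3) :
    scaleTriple h q j = q * h j := by
  simp [scaleTriple]

/-- The partial derivatives are forms of degree D, so an element of J_f of degree k has coefficients
that may be replaced by their components of degree k - D. -/
theorem finrank_milnorAlgebraPart_add {f : Form} {D k : ℕ} (hf : f.IsHomogeneous (D + 1))
    (hk : D ≤ k) :
    Module.finrank ℂ (milnorAlgebraPart f k) +
      Module.finrank ℂ ((homogeneousTriples fun _ => k - D).map (gradientPairing f)) =
      (k + 2).choose 2 := by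
  rw [← finrank_homogeneousSubmodule, milnorAlgebraPart]
  have hfi : ∀ i, (pderiv i f).IsHomogeneous D := fun i => by simpa using hf.pderiv (i := i)
  suffices e : (homogeneousTriples fun _ => k - D).map (gradientPairing f) =
      homogeneousSubmodule (Fin 3) ℂ k ⊓
        LinearMap.ker (Ideal.Quotient.mkₐ ℂ (jacobianIdeal f)).toLinearMap by
    rw [e, finrank_map_add_finrank_inf_ker]
  ext g
  rw [Submodule.mem_inf, LinearMap.mem_ker, mem_homogeneousSubmodule, Submodule.mem_map]
  simp only [AlgHom.toLinearMap_apply, Ideal.Quotient.mkₐ_eq_mk, Ideal.Quotient.eq_zero_iff_mem]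
  constructor
  · rintro ⟨v, hv, rfl⟩
    rw [mem_homogeneousTriples] at hv
    have hm : ∀ i, (v i * pderiv i f).IsHomogeneous k := fun i => by
      simpa [Nat.sub_add_cancel hk] using (hv i).mul (hfi i)
    have hJ : ∀ i, v i * pderiv i f ∈ jacobianIdeal f := fun i =>
      Ideal.mul_mem_left _ _ (Ideal.subset_span ⟨i, rfl⟩)
    rw [gradientPairing_apply]
    exact ⟨((hm 0).add (hm 1)).add (hm 2), add_mem (add_mem (hJ 0) (hJ 1)) (hJ 2)⟩
  · rintro ⟨hg, hJ⟩
    rw [jacobianIdeal, Ideal.mem_span_range_iff_exists_fun] at hJ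
    obtain ⟨c, hc⟩ := hJ
    refine ⟨fun i => homogeneousComponent (k - D) (c i), mem_homogeneousTriples.2 fun i =>
      homogeneousComponent_isHomogeneous _ _, ?_⟩
    rw [gradientPairing_apply, ← homogeneousComponent_eq_self hg, ← hc, Fin.sum_univ_three,
      map_add, map_add]
    simp only [homogeneousComponent_mul_of_isHomogeneous (hfi _) hk]

namespace IsHilbertBurch
variable {f : Form} {ρ : Fin 3 → Fin 3 → Form} {h : Fin 3 → Form}

/-- The Hilbert function of the Milnor algebra, read off from the graded free resolution. -/
theorem finrank_milnorAlgebraPart (H : IsHilbertBurch f ρ h) {D e n : ℕ} (hp : Prime f)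
    (hf : f.IsHomogeneous (D + 1)) (h0 : pderiv 0 f ≠ 0) {d : Fin 3 → ℕ} (hd : ∀ j, d j ≤ e)
    (hρ : ∀ j i, (ρ j i).IsHomogeneous (d j)) (hh : ∀ j, (h j).IsHomogeneous (e - d j)) :
    Module.finrank ℂ (milnorAlgebraPart f (n + e + D)) + 3 * (n + e + 2).choose 2 +
        (n + 2).choose 2 =
      (n + e + D + 2).choose 2 + ∑ j, (n + e - d j + 2).choose 2 := by
  -- `s2`, `s3`, `s4` are rank–nullity for the three maps of the resolution in one degree; `k2`,
  -- `k3`, `k4` identify each kernel with the previous image. Writing the degree as n + e + D with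
  -- every d j ≤ e keeps the natural subtractions from truncating.
  have s1 := finrank_milnorAlgebraPart_add (k := n + e + D) hf (by omega)
  have s2 := finrank_map_add_finrank_inf_ker (gradientPairing f)
    (homogeneousTriples fun _ => n + e + D - D)
  have s3 := finrank_map_add_finrank_inf_ker (combine ρ)
    (homogeneousTriples fun j => n + e - d j)
  have s4 := finrank_map_add_finrank_inf_ker (scaleTriple h) (homogeneousSubmodule (Fin 3) ℂ n)
  have k4 : homogeneousSubmodule (Fin 3) ℂ n ⊓ LinearMap.ker (scaleTriple h) = ⊥ := by
    rw [eq_bot_iff]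
    rintro q ⟨-, hq⟩
    have := congrFun (LinearMap.mem_ker.1 hq) 2
    rw [scaleTriple_apply] at this
    simpa [H.ne_zero] using this
  have k3 : homogeneousTriples (fun j => n + e - d j) ⊓ LinearMap.ker (combine ρ) =
      (homogeneousSubmodule (Fin 3) ℂ n).map (scaleTriple h) := by
    ext c
    rw [Submodule.mem_inf, mem_homogeneousTriples, LinearMap.mem_ker, Submodule.mem_map]
    constructor
    · rintro ⟨hc, hc0⟩
      obtain ⟨q, hq⟩ := H.eq_mul_of_sum_eq_zero h0 (c := c) fun i => by
        rw [← combine_apply, hc0]; rfl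
      refine ⟨homogeneousComponent n q, homogeneousComponent_isHomogeneous _ _, ?_⟩
      ext1 j
      have hj := hd j
      rw [scaleTriple_apply, ← homogeneousComponent_eq_self (hc j), hq,
        homogeneousComponent_mul_of_isHomogeneous (hh j) (by omega)]
      rw [show n + e - d j - (e - d j) = n by omega]
    · rintro ⟨q, hq, rfl⟩
      refine ⟨fun j => ?_, ?_⟩
      · rw [scaleTriple_apply]
        have := ((mem_homogeneousSubmodule _ _).1 hq).mul (hh j)
        rwa [← Nat.add_sub_assoc (hd j)] at this
      · ext1 i
        rw [combine_apply]
        simp only [scaleTriple_apply, Pi.zero_apply]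
        linear_combination q * H.rel i
  have k2 : homogeneousTriples (fun _ => n + e + D - D) ⊓ LinearMap.ker (gradientPairing f) =
      (homogeneousTriples fun j => n + e - d j).map (combine ρ) := by
    ext v
    rw [Submodule.mem_inf, mem_homogeneousTriples, LinearMap.mem_ker, Submodule.mem_map,
      Nat.add_sub_cancel, gradientPairing_apply, ← mem_jacobianSyzygies]
    constructor
    · rintro ⟨hv, hv0⟩
      obtain ⟨c, hc⟩ := H.exists_eq_sum hp hf h0 hv0
      refine ⟨fun j => homogeneousComponent (n + e - d j) (c j), mem_homogeneousTriples.2 fun j =>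
        homogeneousComponent_isHomogeneous _ _, ?_⟩
      have hle : ∀ j, d j ≤ n + e := fun j => (hd j).trans (by omega)
      ext1 i
      rw [combine_apply, ← homogeneousComponent_eq_self (hv i), hc, map_add, map_add]
      simp only [homogeneousComponent_mul_of_isHomogeneous (hρ _ i) (hle _)]
    · rintro ⟨c, hc, rfl⟩
      rw [mem_homogeneousTriples] at hc
      have hle : ∀ j, d j ≤ n + e := fun j => (hd j).trans (by omega)
      have hm : ∀ j i, (c j * ρ j i).IsHomogeneous (n + e) := fun j i => by
        simpa [Nat.sub_add_cancel (hle j)] using (hc j).mul (hρ j i)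
      have : combine ρ c = c 0 • ρ 0 + c 1 • ρ 1 + c 2 • ρ 2 := by
        ext1 i; simp [combine_apply]
      refine ⟨fun i => ?_, ?_⟩
      · rw [combine_apply]
        exact ((hm 0 i).add (hm 1 i)).add (hm 2 i)
      · rw [this]
        exact add_mem (add_mem (Submodule.smul_mem _ _ (H.mem_of_first 0))
          (Submodule.smul_mem _ _ (H.mem_of_first 1))) (Submodule.smul_mem _ _ (H.mem_of_first 2))
  rw [k2, finrank_homogeneousTriples] at s2
  rw [k3, finrank_homogeneousTriples] at s3
  rw [k4, finrank_bot, finrank_homogeneousSubmodule] at s4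
  simp only [Nat.add_sub_cancel, Finset.sum_const, Finset.card_univ, Fintype.card_fin,
    smul_eq_mul] at s1 s2
  omega

end IsHilbertBurch
end PlaneCurve

namespace PlaneCurve
open MvPolynomial

/-! ### Homogenization and dehomogenization -/

/-- Setting `z = 1`. -/
noncomputable def dehomogenize : Form →ₐ[ℂ] MvPolynomial (Fin 2) ℂ :=
  aeval ![X 0, X 1, 1]

@[simp] theorem dehomogenize_X_zero : dehomogenize (X 0) = X 0 := by simp [dehomogenize]
@[simp] theorem dehomogenize_X_one : dehomogenize (X 1) = X 1 := by simp [dehomogenize]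
@[simp] theorem dehomogenize_X_two : dehomogenize (X 2) = 1 := by simp [dehomogenize]
@[simp] theorem dehomogenize_C (a : ℂ) : dehomogenize (C a) = C a := by simp [dehomogenize]

theorem degree_eq_of_mem_support {a : Form} {n : ℕ} (ha : a.IsHomogeneous n) {d : Fin 3 →₀ ℕ}
    (hd : d ∈ a.support) : d.degree = n := by
  by_contra h
  exact mem_support_iff.1 hd (ha.coeff_eq_zero h)

theorem isHomogeneous_eval_smul {a : Form} {n : ℕ} (ha : a.IsHomogeneous n) (r : ℂ)
    (v : Fin 3 → ℂ) : eval (r • v) a = r ^ n * eval v a := by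
  rw [eval_eq, eval_eq, Finset.mul_sum]
  refine Finset.sum_congr rfl fun d hd => ?_
  have hdn : ∑ i ∈ d.support, d i = n := by
    rw [← degree_eq_of_mem_support ha hd, Finsupp.degree_apply]
  simp only [Pi.smul_apply, smul_eq_mul, mul_pow, Finset.prod_mul_distrib]
  rw [Finset.prod_pow_eq_pow_sum, hdn]
  ring

/-- By homogeneity a form that vanishes on z = 1 vanishes wherever z ≠ 0, so z times it is the zero
function. -/
theorem eq_zero_of_dehomogenize_eq_zero {a : Form} {n : ℕ} (ha : a.IsHomogeneous n)
    (h : dehomogenize a = 0) : a = 0 := by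
  have h1 : ∀ u v : ℂ, eval ![u, v, 1] a = 0 := fun u v => by
    have := congrArg (eval ![u, v]) h
    rw [map_zero, dehomogenize, aeval_def, eval_eval₂] at this
    rw [← this, ← eval₂_id]
    congr 1
    · ext; simp
    · ext i; fin_cases i <;> simp
  have h2 : X 2 * a = 0 := by
    apply MvPolynomial.funext
    intro v
    rw [map_mul, eval_X, map_zero]
    by_cases hv : v 2 = 0
    · simp [hv]
    · have : v = v 2 • ![v 0 / v 2, v 1 / v 2, 1] := by
        ext i; fin_cases i <;> simp [mul_div_cancel₀ _ hv]
      rw [this, isHomogeneous_eval_smul ha, h1]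
      simp
  exact (mul_eq_zero.1 h2).resolve_left (X_ne_zero _)

theorem eq_of_dehomogenize_eq {a b : Form} {n : ℕ} (ha : a.IsHomogeneous n)
    (hb : b.IsHomogeneous n) (h : dehomogenize a = dehomogenize b) : a = b :=
  sub_eq_zero.1 (eq_zero_of_dehomogenize_eq_zero (ha.sub hb) (by rw [map_sub, h, sub_self]))

theorem le_totalDegree_of_mem_support {q : MvPolynomial (Fin 2) ℂ} {m : Fin 2 →₀ ℕ}
    (hm : m ∈ q.support) : m 0 + m 1 ≤ q.totalDegree := by
  have := le_totalDegree hm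
  rwa [Finsupp.sum_fintype _ _ (fun _ => rfl), Fin.sum_univ_two] at this

theorem isHomogeneous_homogenize (q : MvPolynomial (Fin 2) ℂ) :
    (homogenize q).IsHomogeneous q.totalDegree := by
  refine IsHomogeneous.sum _ _ _ fun m hm => ?_
  have h := (((isHomogeneous_C (Fin 3) (q.coeff m)).mul (isHomogeneous_X_pow (R := ℂ) (0 : Fin 3) (m 0))).mul
    (isHomogeneous_X_pow (R := ℂ) (1 : Fin 3) (m 1))).mul
    (isHomogeneous_X_pow (R := ℂ) (2 : Fin 3) (q.totalDegree - (m 0 + m 1)))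
  have := le_totalDegree_of_mem_support hm
  rwa [show 0 + m 0 + m 1 + (q.totalDegree - (m 0 + m 1)) = q.totalDegree by omega] at h

theorem dehomogenize_homogenize (q : MvPolynomial (Fin 2) ℂ) :
    dehomogenize (homogenize q) = q := by
  conv_rhs => rw [q.as_sum]
  rw [homogenize, map_sum]
  refine Finset.sum_congr rfl fun m _ => ?_
  rw [monomial_eq, Finsupp.prod_fintype _ _ (fun _ => pow_zero _), Fin.prod_univ_two]
  simp [mul_assoc]

theorem X_two_prime : Prime (X 2 : Form) := X_prime

/-- Setting z = 1 lowers the degree of a form only if z divides it. -/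
theorem homogenize_dehomogenize {F : Form} {n : ℕ} (hF : F.IsHomogeneous n)
    (hz : ¬ (X 2 : Form) ∣ F) : homogenize (dehomogenize F) = F := by
  have h1 := isHomogeneous_homogenize (dehomogenize F)
  have h2 := dehomogenize_homogenize (dehomogenize F)
  set H := homogenize (dehomogenize F)
  set d := (dehomogenize F).totalDegree
  rcases lt_trichotomy d n with hd | hd | hd
  · exfalso
    have : H * X 2 ^ (n - d) = F := eq_of_dehomogenize_eq (n := n)
      (by simpa [Nat.add_sub_cancel' hd.le] using h1.mul (isHomogeneous_X_pow (2 : Fin 3) (n - d)))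
      hF (by simp [h2])
    exact hz (this ▸ (dvd_pow_self _ (by omega)).mul_left _)
  · exact eq_of_dehomogenize_eq (hd ▸ h1) hF h2
  · have e : H = F * X 2 ^ (d - n) := eq_of_dehomogenize_eq h1
      (by simpa [Nat.add_sub_cancel' hd.le] using hF.mul (isHomogeneous_X_pow (2 : Fin 3) (d - n)))
      (by simp [h2])
    exfalso
    have hle : (dehomogenize F).totalDegree ≤ n := by
      rw [F.as_sum, map_sum]
      refine totalDegree_finsetSum_le fun m hm => ?_
      have hdn : m 0 + m 1 + m 2 = n := by
        rw [← degree_eq_of_mem_support hF hm, Finsupp.degree_eq_sum, Fin.sum_univ_three]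
      rw [monomial_eq, Finsupp.prod_fintype _ _ (fun _ => pow_zero _), Fin.prod_univ_three]
      simp only [map_mul, map_pow, dehomogenize_C, dehomogenize_X_zero, dehomogenize_X_one,
        dehomogenize_X_two, one_pow, mul_one]
      refine (totalDegree_mul _ _).trans ?_
      rw [totalDegree_C]
      refine (Nat.add_le_add_left (totalDegree_mul _ _) _).trans ?_
      rw [totalDegree_X_pow, totalDegree_X_pow]
      omega
    omega

/-- A homogeneous ideal may be tested for primality on forms. For forms, divisibility by F can be
checked after z = 1: it holds up to a power of z, which cancels because z does not divide F. -/
theorem prime_of_prime_dehomogenize {F : Form} {n : ℕ} (hF : F.IsHomogeneous n)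
    (hz : ¬ (X 2 : Form) ∣ F) (hp : Prime (dehomogenize F)) : Prime F := by
  have hF0 : F ≠ 0 := by rintro rfl; simp at hz
  rw [← Ideal.span_singleton_prime hF0]
  let _ := MvPolynomial.gradedAlgebra (σ := Fin 3) (R := ℂ)
  refine Ideal.IsHomogeneous.isPrime_of_homogeneous_mem_or_mem
    (𝒜 := homogeneousSubmodule (Fin 3) ℂ) (Ideal.homogeneous_span _ _ ?_) ?_ ?_
  · rintro x rfl
    exact ⟨n, hF⟩
  · rw [Ne, Ideal.span_singleton_eq_top]
    exact fun h => hp.not_isUnit (h.map dehomogenize)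
  have key : ∀ {a : Form} {k : ℕ}, a.IsHomogeneous k → dehomogenize F ∣ dehomogenize a →
      F ∣ a := by
    rintro a k ha ⟨c, hc⟩
    have hh := hF.mul (isHomogeneous_homogenize c)
    have hd : dehomogenize (F * homogenize c) = dehomogenize a := by
      rw [map_mul, dehomogenize_homogenize, hc]
    set m := n + c.totalDegree
    rcases le_total m k with h | h
    · have e : F * homogenize c * X 2 ^ (k - m) = a := eq_of_dehomogenize_eq
        (by simpa [Nat.add_sub_cancel' h] using hh.mul (isHomogeneous_X_pow (2 : Fin 3) (k - m)))
        ha (by rw [map_mul, hd]; simp)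
      rw [← e, mul_assoc]
      exact dvd_mul_right _ _
    · have e : F * homogenize c = a * X 2 ^ (m - k) := eq_of_dehomogenize_eq hh
        (by simpa [Nat.add_sub_cancel' h] using ha.mul (isHomogeneous_X_pow (2 : Fin 3) (m - k)))
        (by rw [hd, map_mul]; simp)
      obtain ⟨r, hr⟩ := X_two_prime.pow_dvd_of_dvd_mul_left (m - k) hz ⟨a, e.trans (mul_comm _ _)⟩
      refine ⟨r, mul_right_cancel₀ (pow_ne_zero (m - k) (X_ne_zero (R := ℂ) (2 : Fin 3))) ?_⟩
      rw [← e, hr]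
      ring
  rintro a b ⟨i, ha⟩ ⟨j, hb⟩ hab
  rw [Ideal.mem_span_singleton] at hab ⊢
  rw [Ideal.mem_span_singleton]
  have h := map_dvd dehomogenize hab
  rw [map_mul] at h
  exact (hp.dvd_or_dvd h).imp (key ha) (key hb)

/-! ### The explicit equation of the fibers -/

/-- The equation of `C'_t`, written out. -/
noncomputable def fiberForm (t : ℂ) : Form :=
  (X 0 * (X 0 * X 1 + X 2 ^ 2) + X 2 ^ 3) ^ 2 * ((X 0 * X 1 + X 2 ^ 2) ^ 2 + X 1 * X 2 ^ 3)
    - C (7 / 9) * ((X 0 * (X 0 * X 1 + X 2 ^ 2) + X 2 ^ 3) * (X 0 * X 1 + X 2 ^ 2) * X 2 ^ 5)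
    + C (1 / 9) * ((X 0 * X 1 + X 2 ^ 2) * X 2 ^ 8) - C t * X 2 ^ 10

theorem isHomogeneous_fiberForm (t : ℂ) : (fiberForm t).IsHomogeneous 10 := by
  have hX : ∀ i : Fin 3, (X i : Form).IsHomogeneous 1 := isHomogeneous_X ℂ
  have hz : ∀ n, (X 2 ^ n : Form).IsHomogeneous n := isHomogeneous_X_pow 2
  have hS : (X 0 * X 1 + X 2 ^ 2 : Form).IsHomogeneous 2 := ((hX 0).mul (hX 1)).add (hz 2)
  have hP : (X 0 * (X 0 * X 1 + X 2 ^ 2) + X 2 ^ 3 : Form).IsHomogeneous 3 :=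
    ((hX 0).mul hS).add (hz 3)
  have hU : ((X 0 * X 1 + X 2 ^ 2) ^ 2 + X 1 * X 2 ^ 3 : Form).IsHomogeneous 4 :=
    (hS.pow 2).add ((hX 1).mul (hz 3))
  exact ((((hP.pow 2).mul hU).sub (((hP.mul hS).mul (hz 5)).C_mul _)).add
    ((hS.mul (hz 8)).C_mul _)).sub ((hz 10).C_mul _)

theorem dehomogenize_fiberForm (t : ℂ) : dehomogenize (fiberForm t) = g' - C t := by
  simp only [fiberForm, g', p, u, s, map_sub, map_add, map_mul, map_pow, dehomogenize_X_zero,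
    dehomogenize_X_one, dehomogenize_X_two, dehomogenize_C]
  ring

theorem not_X_two_dvd_fiberForm (t : ℂ) : ¬ (X 2 : Form) ∣ fiberForm t := by
  rintro ⟨q, hq⟩
  have := congrArg (eval ![1, 1, 0]) hq
  simp [fiberForm] at this

theorem C'_eq_fiberForm (t : ℂ) : C' t = fiberForm t := by
  rw [C', ← dehomogenize_fiberForm,
    homogenize_dehomogenize (isHomogeneous_fiberForm t) (not_X_two_dvd_fiberForm t)]

end PlaneCurve

namespace PlaneCurve
open MvPolynomial

/-! ### Irreducibility of the fibers -/

theorem not_isSquare_of_isCoprime_derivative {D : Polynomial ℂ} (h : IsCoprime D D.derivative)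
    (hD : ¬ IsUnit D) : ¬ IsSquare D := by
  rintro ⟨e, rfl⟩
  obtain ⟨a, b, hab⟩ := h
  apply hD
  have : IsUnit e := IsUnit.of_mul_eq_one (a * e + b * (2 * e.derivative)) (by
    rw [← hab, Polynomial.derivative_mul]; ring)
  exact this.mul this

/-- A factor of degree 0 divides all three coefficients, hence is a unit. Two linear factors αX + β
and γX + δ would make the discriminant (αδ - βγ)². -/
theorem irreducible_quadratic {R : Type*} [CommRing R] [IsDomain R] {a b c : R} (ha : a ≠ 0)
    (hc : ∀ d, d ∣ a → d ∣ b → d ∣ c → IsUnit d) (hsq : ¬ IsSquare (b ^ 2 - 4 * a * c)) :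
    Irreducible (Polynomial.C a * Polynomial.X ^ 2 + Polynomial.C b * Polynomial.X +
      Polynomial.C c) := by
  set Q := Polynomial.C a * Polynomial.X ^ 2 + Polynomial.C b * Polynomial.X + Polynomial.C c
    with hQdef
  have hdeg : Q.natDegree = 2 := Polynomial.natDegree_quadratic ha
  have hQ0 : Q ≠ 0 := by intro h; simp [h] at hdeg
  have c2 : ∀ a b c : R, (Polynomial.C a * Polynomial.X ^ 2 + Polynomial.C b * Polynomial.X +
      Polynomial.C c).coeff 2 = a := fun a b c => by
    simp
  have c1 : ∀ a b c : R, (Polynomial.C a * Polynomial.X ^ 2 + Polynomial.C b * Polynomial.X +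
      Polynomial.C c).coeff 1 = b := fun a b c => by
    simp [Polynomial.coeff_C]
  have c0 : ∀ a b c : R, (Polynomial.C a * Polynomial.X ^ 2 + Polynomial.C b * Polynomial.X +
      Polynomial.C c).coeff 0 = c := fun a b c => by
    simp
  have h2 : Q.coeff 2 = a := c2 a b c
  have h1 : Q.coeff 1 = b := c1 a b c
  have h0 : Q.coeff 0 = c := c0 a b c
  have hunit : ∀ u v : Polynomial R, Q = u * v → u.natDegree = 0 → IsUnit u := by
    intro u v huv hu
    obtain ⟨r, rfl⟩ : ∃ r, u = Polynomial.C r := ⟨_, Polynomial.eq_C_of_natDegree_eq_zero hu⟩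
    refine (hc r ?_ ?_ ?_).map Polynomial.C
    · exact ⟨v.coeff 2, by rw [← h2, huv, Polynomial.coeff_C_mul]⟩
    · exact ⟨v.coeff 1, by rw [← h1, huv, Polynomial.coeff_C_mul]⟩
    · exact ⟨v.coeff 0, by rw [← h0, huv, Polynomial.coeff_C_mul]⟩
  refine ⟨fun h => ?_, fun u v huv => ?_⟩
  · have := Polynomial.natDegree_eq_zero_of_isUnit h
    omega
  · have hu0 : u ≠ 0 := by rintro rfl; simp at huv; exact hQ0 huv
    have hv0 : v ≠ 0 := by rintro rfl; simp at huv; exact hQ0 huv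
    have hs : u.natDegree + v.natDegree = 2 := by
      rw [← Polynomial.natDegree_mul hu0 hv0, ← huv, hdeg]
    rcases Nat.eq_zero_or_pos u.natDegree with hu | hu
    · exact Or.inl (hunit u v huv hu)
    rcases Nat.eq_zero_or_pos v.natDegree with hv | hv
    · exact Or.inr (hunit v u (huv.trans (mul_comm _ _)) hv)
    exfalso
    have hu1 := Polynomial.eq_X_add_C_of_natDegree_le_one (p := u) (by omega)
    have hv1 := Polynomial.eq_X_add_C_of_natDegree_le_one (p := v) (by omega)
    generalize u.coeff 1 = α at hu1
    generalize u.coeff 0 = β at hu1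
    generalize v.coeff 1 = γ at hv1
    generalize v.coeff 0 = δ at hv1
    have e : Q = Polynomial.C (α * γ) * Polynomial.X ^ 2 +
        Polynomial.C (α * δ + β * γ) * Polynomial.X + Polynomial.C (β * δ) := by
      rw [huv, hu1, hv1]
      simp only [map_mul, map_add]
      ring
    have ea : a = α * γ := by rw [← h2, e, c2]
    have eb : b = α * δ + β * γ := by rw [← h1, e, c1]
    have ec : c = β * δ := by rw [← h0, e, c0]
    exact hsq ⟨α * δ - β * γ, by rw [ea, eb, ec]; ring⟩

/-! ### The birational coordinates p and s -/

/-- The substitution `P ↦ p`, `S ↦ s` in polynomials in `S` over `ℂ[P]`. -/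
noncomputable def substitute : Polynomial (Polynomial ℂ) →+* MvPolynomial (Fin 2) ℂ :=
  Polynomial.eval₂RingHom (Polynomial.aeval p : Polynomial ℂ →ₐ[ℂ] _).toRingHom s

@[simp] theorem substitute_X : substitute Polynomial.X = s := by simp [substitute]
@[simp] theorem substitute_C (a : Polynomial ℂ) :
    substitute (Polynomial.C a) = Polynomial.aeval p a := by simp [substitute]

/-- The field `ℂ(P, S)`. -/
abbrev FracPS := FractionRing (Polynomial (Polynomial ℂ))

/-- The variable `P` of `ℂ(P, S)`. -/
noncomputable def fracP : FracPS :=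
  algebraMap (Polynomial (Polynomial ℂ)) FracPS (Polynomial.C Polynomial.X)

/-- The variable `S` of `ℂ(P, S)`. -/
noncomputable def fracS : FracPS := algebraMap (Polynomial (Polynomial ℂ)) FracPS Polynomial.X

/-- The coordinates `x`, `y` as rational functions of `p` and `s`. -/
noncomputable def resolve : MvPolynomial (Fin 2) ℂ →ₐ[ℂ] FracPS :=
  aeval ![(fracP - 1) / fracS, fracS * (fracS - 1) / (fracP - 1)]

/-- This left inverse shows that p and s are algebraically independent. -/
theorem resolve_substitute (a : Polynomial (Polynomial ℂ)) :
    resolve (substitute a) = algebraMap _ FracPS a := by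
  have hinj := IsFractionRing.injective (Polynomial (Polynomial ℂ)) FracPS
  have hS : fracS ≠ 0 := by
    rw [fracS, Ne, map_eq_zero_iff _ hinj]
    exact Polynomial.X_ne_zero
  have hP : fracP - 1 ≠ 0 := by
    rw [fracP, ← map_one (algebraMap (Polynomial (Polynomial ℂ)) FracPS), ← map_sub, Ne,
      map_eq_zero_iff _ hinj, ← Polynomial.C_1, ← Polynomial.C_sub, Polynomial.C_eq_zero]
    exact Polynomial.X_sub_C_ne_zero 1
  have hs : resolve s = fracS := by
    simp only [resolve, s, map_add, map_mul, aeval_X, map_one]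
    simp only [Matrix.cons_val_zero, Matrix.cons_val_one]
    field_simp
    ring
  have hp : resolve p = fracP := by
    rw [p, map_add, map_mul, hs, map_one, resolve, aeval_X]
    simp only [Matrix.cons_val_zero]
    field_simp
    ring
  have : (resolve : MvPolynomial (Fin 2) ℂ →+* FracPS).comp substitute = algebraMap _ _ := by
    refine Polynomial.ringHom_ext' (Polynomial.ringHom_ext' ?_ ?_) ?_
    · ext a
      simp only [RingHom.comp_apply, RingHom.coe_coe, substitute_C, Polynomial.aeval_C,
        AlgHom.commutes]
      rfl
    · simp [hp, fracP]
    · simp [hs, fracS]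
  exact congrArg (fun φ => φ a) this

theorem substitute_injective : Function.Injective substitute := fun a b h =>
  IsFractionRing.injective (Polynomial (Polynomial ℂ))
    (FractionRing (Polynomial (Polynomial ℂ)))
    (by rw [← resolve_substitute, h, resolve_substitute])

/-- `S (P - 1)`, which becomes `x s²`. -/
noncomputable def denominatorPoly : Polynomial (Polynomial ℂ) :=
  Polynomial.X * Polynomial.C (Polynomial.X - 1)

theorem substitute_denominatorPoly : substitute denominatorPoly = X 0 * s ^ 2 := by
  simp only [denominatorPoly, map_mul, substitute_X, substitute_C, map_sub, Polynomial.aeval_X,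
    map_one]
  rw [p]
  ring

/-- Both coordinates become polynomials in p and s after multiplication by x s²: x · x s² = (p - 1)²
and y · x s² = s²(s - 1). -/
theorem exists_substitute_eq (a : MvPolynomial (Fin 2) ℂ) :
    ∃ N b, substitute b = (X 0 * s ^ 2) ^ N * a := by
  induction a using MvPolynomial.induction_on with
  | C r => exact ⟨0, Polynomial.C (Polynomial.C r), by simp⟩
  | add a b ha hb =>
    obtain ⟨m, a', ha⟩ := ha
    obtain ⟨n, b', hb⟩ := hb
    refine ⟨m + n, denominatorPoly ^ n * a' + denominatorPoly ^ m * b', ?_⟩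
    simp only [map_add, map_mul, map_pow, substitute_denominatorPoly, ha, hb]
    ring
  | mul_X a i ha =>
    obtain ⟨m, a', ha⟩ := ha
    fin_cases i
    · refine ⟨m + 1, Polynomial.C (Polynomial.X - 1) ^ 2 * a', ?_⟩
      simp only [map_mul, map_pow, substitute_C, map_sub, map_one, Polynomial.aeval_X, ha,
        Fin.mk_zero]
      rw [p]
      ring
    · refine ⟨m + 1, Polynomial.X ^ 2 * (Polynomial.X - 1) * a', ?_⟩
      simp only [map_mul, map_pow, substitute_X, map_sub, map_one, ha, Fin.mk_one]
      nth_rw 2 [s]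
      ring

theorem s_prime : Prime s := by
  have : Irreducible (X 0 * X 1 + 1 : MvPolynomial (Fin 2) ℂ) := by
    apply irreducible_mul_X_add _ _ _ (X_ne_zero _)
    · simp [vars_X]
    · rw [← C_1]; simp
    · exact isRelPrime_one_right
  exact this.prime

theorem dvd_of_dvd_prime_mul {R : Type*} [CommRing R] [IsDomain R] {q g a : R} (hq : Prime q)
    (hg : ¬ q ∣ g) (h : g ∣ q * a) : g ∣ a := by
  obtain ⟨c, hc⟩ := h
  obtain ⟨c', rfl⟩ := (hq.dvd_or_dvd ⟨a, hc.symm⟩).resolve_left hg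
  exact ⟨c', mul_left_cancel₀ hq.ne_zero (by rw [hc]; ring)⟩

/-- An irreducible equation in `p` and `s` gives an irreducible equation in `x` and `y`, up to the
factors `x` and `s` that are invertible in the change of variables. -/
theorem prime_of_substitute {Q : Polynomial (Polynomial ℂ)} (hQ : Prime Q)
    (hX : ¬ Q ∣ Polynomial.X) (hP : ¬ Q ∣ Polynomial.C (Polynomial.X - 1))
    {g m : MvPolynomial (Fin 2) ℂ} (hQg : substitute Q = m * g) (hm : m ∣ X 0 * s ^ 2)
    (hgx : ¬ X 0 ∣ g) (hgs : ¬ s ∣ g) : Prime g := by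
  have hE : ¬ Q ∣ denominatorPoly := fun h => (hQ.dvd_or_dvd h).elim hX hP
  obtain ⟨m', hm'⟩ := hm
  -- `key1` and `key3` translate between divisibility by g and by Q for elements that agree up to
  -- powers of x s². The extra factors cancel because Q does not divide S(P - 1) (`hE`) and neither
  -- x nor s is divisible by g (`key2`).
  have key1 : ∀ {a N a'}, substitute a' = (X 0 * s ^ 2) ^ N * a → g ∣ a → Q ∣ a' := by
    rintro _ N a' ha ⟨c, rfl⟩
    obtain ⟨M, c', hc⟩ := exists_substitute_eq (m' * c)
    have : denominatorPoly ^ (M + 1) * a' = Q * (denominatorPoly ^ N * c') := by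
      apply substitute_injective
      simp only [map_mul, map_pow, substitute_denominatorPoly, ha, hc, hQg]
      rw [pow_succ]
      nth_rw 2 [hm']
      ring
    rcases hQ.dvd_or_dvd ⟨_, this⟩ with h | h
    · exact absurd (hQ.dvd_of_dvd_pow h) hE
    · exact h
  have key2 : ∀ (N : ℕ) {a}, g ∣ (X 0 * s ^ 2) ^ N * a → g ∣ a := by
    intro N
    induction N with
    | zero => intro a h; simpa using h
    | succ N ih =>
      intro a h
      apply ih
      refine dvd_of_dvd_prime_mul s_prime hgs (dvd_of_dvd_prime_mul s_prime hgs
        (dvd_of_dvd_prime_mul (X_prime (i := 0)) hgx ?_))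
      convert h using 1
      ring
  have key3 : ∀ {a N a'}, substitute a' = (X 0 * s ^ 2) ^ N * a → Q ∣ a' → g ∣ a := by
    rintro a N _ ha ⟨c, rfl⟩
    apply key2 N
    rw [← ha, map_mul, hQg]
    exact ⟨m * substitute c, by ring⟩
  refine ⟨?_, fun h => ?_, fun a b hab => ?_⟩
  · rintro rfl
    exact hgx (dvd_zero _)
  · exact hQ.not_isUnit (isUnit_of_dvd_one (key1 (a := 1) (N := 0) (a' := 1) (by simp) h.dvd))
  · obtain ⟨M, a', ha⟩ := exists_substitute_eq a
    obtain ⟨N, b', hb⟩ := exists_substitute_eq b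
    have := key1 (a := a * b) (N := M + N) (a' := a' * b')
      (by rw [map_mul, ha, hb]; ring) hab
    exact (hQ.dvd_or_dvd this).imp (key3 ha) (key3 hb)

theorem not_X_dvd_fiber (t : ℂ) : ¬ X 0 ∣ g' - C t := by
  rintro ⟨q, hq⟩
  -- On x = 0 the polynomial g' is y + 1/3, so g' - t takes the value 1 here.
  have := congrArg (eval ![0, t + 2 / 3]) hq
  simp [g', p, s, u] at this
  ring_nf at this
  norm_num at this

theorem not_s_dvd_fiber (t : ℂ) : ¬ s ∣ g' - C t := by
  rintro ⟨q, hq⟩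
  -- On s = 0 one has p = 1 and u = y, hence g' = y. Two points of this curve with different y
  -- cannot both lie on the same fiber.
  have h1 := congrArg (eval ![-1, 1]) hq
  have h2 := congrArg (eval ![-1 / 2, 2]) hq
  simp [g', p, s, u] at h1 h2
  have h3 : (1 : ℂ) = 2 := by linear_combination h1 - h2
  norm_num at h3

/-- `81` times the discriminant of the equation of the fiber over `t`, as a quadratic equation for
`s` over `ℂ(p)`. -/
noncomputable def branchPoly (t : ℂ) : Polynomial ℂ :=
  (4 * Polynomial.X - 1) ^ 4 + Polynomial.C (324 * t) * Polynomial.X ^ 3 * (Polynomial.X - 1)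

theorem isUnit_ofNat_polynomial (n : ℕ) [n.AtLeastTwo] :
    IsUnit (OfNat.ofNat n : Polynomial ℂ) := by
  rw [← Polynomial.C_ofNat]
  exact ((isUnit_iff_ne_zero.2 (OfNat.ofNat_ne_zero n))).map Polynomial.C

theorem isCoprime_X_pow_sq : IsCoprime (Polynomial.X ^ 3 : Polynomial ℂ)
    ((4 * Polynomial.X - 1) ^ 2) :=
  IsCoprime.pow ⟨4, -1, by ring⟩

/-- The quadratic 9P³S² - (4P - 1)²S - 9t(P - 1) becomes 9xs(g' - t). It is primitive because P³ and
(4P - 1)² are coprime, and its discriminant `branchPoly t` is separable and nonconstant, hence not a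
square. -/
theorem prime_fiber_of_isCoprime {t : ℂ}
    (h : IsCoprime (branchPoly t) (branchPoly t).derivative) (hu : ¬ IsUnit (branchPoly t)) :
    Prime (g' - C t) := by
  have hirr := irreducible_quadratic (a := (9 * Polynomial.X ^ 3 : Polynomial ℂ))
    (b := -(4 * Polynomial.X - 1) ^ 2) (c := Polynomial.C (-9 * t) * (Polynomial.X - 1))
    (mul_ne_zero (isUnit_ofNat_polynomial 9).ne_zero (pow_ne_zero _ Polynomial.X_ne_zero))
    (fun d h1 h2 _ => isCoprime_X_pow_sq.isUnit_of_dvd'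
      ((isUnit_ofNat_polynomial 9).dvd_mul_left.1 h1) ((dvd_neg).1 h2))
    (by
      have e : (-(4 * Polynomial.X - 1) ^ 2) ^ 2 - 4 * (9 * Polynomial.X ^ 3) *
          (Polynomial.C (-9 * t) * (Polynomial.X - 1)) = branchPoly t := by
        simp only [branchPoly, map_mul, map_neg, map_ofNat]
        ring
      rw [e]
      exact not_isSquare_of_isCoprime_derivative h hu)
  have hdeg := Polynomial.natDegree_quadratic (R := Polynomial ℂ)
    (a := (9 * Polynomial.X ^ 3 : Polynomial ℂ))
    (b := -(4 * Polynomial.X - 1) ^ 2) (c := Polynomial.C (-9 * t) * (Polynomial.X - 1))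
    (mul_ne_zero (isUnit_ofNat_polynomial 9).ne_zero (pow_ne_zero _ Polynomial.X_ne_zero))
  refine prime_of_substitute hirr.prime ?_ ?_ (m := C 9 * (X 0 * s)) ?_ ?_ (not_X_dvd_fiber t)
    (not_s_dvd_fiber t)
  · intro hd
    have := Polynomial.natDegree_le_of_dvd hd Polynomial.X_ne_zero
    rw [hdeg, Polynomial.natDegree_X] at this
    omega
  · intro hd
    have := Polynomial.natDegree_le_of_dvd hd
      (by rw [Ne, Polynomial.C_eq_zero]; exact Polynomial.X_sub_C_ne_zero 1)
    rw [hdeg, Polynomial.natDegree_C] at this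
    omega
  · simp only [map_add, map_mul, map_pow, map_neg, map_sub, map_one, substitute_C, substitute_X,
      Polynomial.aeval_X, map_ofNat, Polynomial.aeval_C, algebraMap_eq]
    rw [g', p, u]
    have h9 : C (7 / 9 : ℂ) * C 9 = (7 : MvPolynomial (Fin 2) ℂ) := by
      rw [← C_mul, ← map_ofNat C 7]; norm_num
    have h1 : C (1 / 9 : ℂ) * C 9 = (1 : MvPolynomial (Fin 2) ℂ) := by
      rw [← C_mul]; norm_num
    simp only [s]
    rw [show (C 9 : MvPolynomial (Fin 2) ℂ) = 9 from map_ofNat C 9] at h9 h1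
    linear_combination (X 0 * (X 0 * X 1 + 1) ^ 2 * (X 0 * (X 0 * X 1 + 1) + 1)) * h9 -
      X 0 * (X 0 * X 1 + 1) ^ 2 * h1
  · exact ⟨C (1 / 9) * s, by
      rw [show C 9 * (X 0 * s) * (C (1 / 9) * s) = C 9 * C (1 / 9) * (X 0 * s ^ 2) by ring,
        ← C_mul]
      norm_num⟩

/-- Here the discriminant is the square (4P - 1)⁴ and the quadratic is divisible by S. The remaining
linear factor 9P³S - (4P - 1)² becomes 9x g'. -/
theorem prime_fiber_zero : Prime (g' - C 0) := by
  have hirr := Polynomial.irreducible_C_mul_X_add_C (a := (9 * Polynomial.X ^ 3 : Polynomial ℂ))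
    (b := -(4 * Polynomial.X - 1) ^ 2)
    (mul_ne_zero (isUnit_ofNat_polynomial 9).ne_zero (pow_ne_zero _ Polynomial.X_ne_zero))
    (fun d h1 h2 => isCoprime_X_pow_sq.isUnit_of_dvd'
      ((isUnit_ofNat_polynomial 9).dvd_mul_left.1 h1) ((dvd_neg).1 h2))
  refine prime_of_substitute hirr.prime ?_ ?_ (m := C 9 * X 0) ?_ ?_ (not_X_dvd_fiber 0)
    (not_s_dvd_fiber 0)
  · intro hd
    have := hirr.dvd_symm Polynomial.irreducible_X hd
    rw [Polynomial.X_dvd_iff] at this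
    simp only [Polynomial.coeff_add, Polynomial.mul_coeff_zero, Polynomial.coeff_C_zero,
      Polynomial.coeff_X_zero, mul_zero, zero_add, neg_eq_zero] at this
    have := congrArg (Polynomial.eval 0) this
    simp at this
  · intro hd
    have := Polynomial.natDegree_le_of_dvd hd
      (by rw [Ne, Polynomial.C_eq_zero]; exact Polynomial.X_sub_C_ne_zero 1)
    rw [Polynomial.natDegree_linear, Polynomial.natDegree_C] at this
    · omega
    · exact mul_ne_zero (isUnit_ofNat_polynomial 9).ne_zero (pow_ne_zero _ Polynomial.X_ne_zero)
  · simp only [map_add, map_mul, map_pow, map_neg, map_sub, map_one, substitute_C, substitute_X,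
      Polynomial.aeval_X, map_ofNat, map_zero]
    rw [g', p, u]
    have h9 : C (7 / 9 : ℂ) * 9 = (7 : MvPolynomial (Fin 2) ℂ) := by
      rw [← map_ofNat C 9, ← C_mul, ← map_ofNat C 7]; norm_num
    have h1 : C (1 / 9 : ℂ) * 9 = (1 : MvPolynomial (Fin 2) ℂ) := by
      rw [← map_ofNat C 9, ← C_mul]; norm_num
    simp only [s]
    linear_combination (X 0 * (X 0 * X 1 + 1) * (X 0 * (X 0 * X 1 + 1) + 1)) * h9 -
      X 0 * (X 0 * X 1 + 1) * h1
  · exact ⟨C (1 / 9) * s ^ 2, by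
      rw [show C 9 * X 0 * (C (1 / 9) * s ^ 2) = C 9 * C (1 / 9) * (X 0 * s ^ 2) by ring,
        ← C_mul]
      norm_num⟩

theorem branchPoly_b' : branchPoly b' = 96 * Polynomial.X ^ 2 - 16 * Polynomial.X + 1 := by
  have : (324 * b' : ℂ) = -256 := by rw [b']; norm_num
  rw [branchPoly, this, map_neg, map_ofNat]
  ring

theorem branchPoly_one : branchPoly 1 = 580 * Polynomial.X ^ 4 - 580 * Polynomial.X ^ 3 +
    96 * Polynomial.X ^ 2 - 16 * Polynomial.X + 1 := by
  rw [branchPoly, mul_one, map_ofNat]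
  ring

theorem isCoprime_of_eq_const {a b c d : Polynomial ℂ} {r : ℂ} (hr : r ≠ 0)
    (h : a * c + b * d = Polynomial.C r) : IsCoprime c d := by
  refine ⟨Polynomial.C r⁻¹ * a, Polynomial.C r⁻¹ * b, ?_⟩
  rw [mul_assoc, mul_assoc, ← mul_add, h, ← Polynomial.C_mul, inv_mul_cancel₀ hr, Polynomial.C_1]

theorem isCoprime_branchPoly_b' : IsCoprime (branchPoly b') (branchPoly b').derivative := by
  apply isCoprime_of_eq_const (a := 24) (b := 1 - 12 * Polynomial.X) (r := 8) (by norm_num)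
  rw [branchPoly_b']
  simp only [Polynomial.derivative_add, Polynomial.derivative_sub, Polynomial.derivative_mul,
    Polynomial.derivative_ofNat, Polynomial.derivative_X_pow, Polynomial.derivative_X,
    Polynomial.derivative_one, map_ofNat, Nat.cast_ofNat]
  ring

theorem isCoprime_branchPoly_one : IsCoprime (branchPoly 1) (branchPoly 1).derivative := by
  apply isCoprime_of_eq_const (a := 141 - 4640 * Polynomial.X + 6960 * Polynomial.X ^ 2)
    (b := 24 - 143 * Polynomial.X + 1595 * Polynomial.X ^ 2 - 1740 * Polynomial.X ^ 3)
    (r := -243) (by norm_num)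
  rw [branchPoly_one]
  simp only [Polynomial.derivative_add, Polynomial.derivative_sub, Polynomial.derivative_mul,
    Polynomial.derivative_ofNat, Polynomial.derivative_X_pow, Polynomial.derivative_X,
    Polynomial.derivative_one, map_ofNat, Nat.cast_ofNat, map_neg]
  ring

theorem not_isUnit_branchPoly_b' : ¬ IsUnit (branchPoly b') := by
  intro h
  have h2 := Polynomial.coeff_eq_zero_of_natDegree_lt (p := branchPoly b') (n := 1)
    (by rw [Polynomial.natDegree_eq_zero_of_isUnit h]; norm_num)
  rw [branchPoly_b'] at h2
  simp [Polynomial.coeff_one, Polynomial.coeff_ofNat_mul, Polynomial.coeff_X_pow] at h2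

theorem not_isUnit_branchPoly_one : ¬ IsUnit (branchPoly 1) := by
  intro h
  have h2 := Polynomial.coeff_eq_zero_of_natDegree_lt (p := branchPoly 1) (n := 1)
    (by rw [Polynomial.natDegree_eq_zero_of_isUnit h]; norm_num)
  rw [branchPoly_one] at h2
  simp [Polynomial.coeff_one, Polynomial.coeff_ofNat_mul, Polynomial.coeff_X_pow] at h2

theorem prime_fiberForm_zero : Prime (fiberForm 0) :=
  prime_of_prime_dehomogenize (isHomogeneous_fiberForm 0) (not_X_two_dvd_fiberForm 0)
    (by rw [dehomogenize_fiberForm]; exact prime_fiber_zero)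

theorem prime_fiberForm_b' : Prime (fiberForm b') :=
  prime_of_prime_dehomogenize (isHomogeneous_fiberForm b') (not_X_two_dvd_fiberForm b') (by
    rw [dehomogenize_fiberForm]
    exact prime_fiber_of_isCoprime isCoprime_branchPoly_b' not_isUnit_branchPoly_b')

theorem prime_fiberForm_one : Prime (fiberForm 1) :=
  prime_of_prime_dehomogenize (isHomogeneous_fiberForm 1) (not_X_two_dvd_fiberForm 1) (by
    rw [dehomogenize_fiberForm]
    exact prime_fiber_of_isCoprime isCoprime_branchPoly_one not_isUnit_branchPoly_one)

end PlaneCurve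

namespace PlaneCurve
open MvPolynomial

/-! ### Explicit Jacobian syzygies of the three fibers -/

/-- The term `c x^i y^j z^k`. -/
noncomputable def mono (c : ℤ) (i j k : ℕ) : Form := (c : Form) * X 0 ^ i * X 1 ^ j * X 2 ^ k

theorem isHomogeneous_mono (c : ℤ) (i j k : ℕ) : (mono c i j k).IsHomogeneous (i + j + k) := by
  have hc : ((c : Form)).IsHomogeneous 0 := by
    rw [← map_intCast (C : ℂ →+* Form)]
    exact isHomogeneous_C _ _
  have := ((hc.mul (isHomogeneous_X_pow (R := ℂ) (0 : Fin 3) i)).mul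
    (isHomogeneous_X_pow (R := ℂ) (1 : Fin 3) j)).mul (isHomogeneous_X_pow (R := ℂ) (2 : Fin 3) k)
  rwa [zero_add] at this

/-- Generators of the Jacobian syzygies of the fiber over `0`. -/
noncomputable def syzygiesZero : Fin 3 → Fin 3 → Form :=
  ![![mono (-2695680) 3 2 0 + mono 4259840 3 1 1 + mono (-926208) 2 1 2 + mono 4259840 2 0 3 +
      mono (-4406400) 1 1 3 + mono 4964352 1 0 4 + mono 2949120 0 0 5,
      mono 4043520 2 3 0 + mono (-6389760) 2 2 1 + mono 3981312 1 2 2 + mono (-8519680) 1 1 3 +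
      mono 6998400 0 2 3 + mono (-3257088) 0 1 4 + mono (-2129920) 0 0 5,
      mono (-622080) 2 2 1 + mono (-1064448) 1 1 3 + mono (-777600) 0 1 4 + mono (-442368) 0 0 5],
    ![mono 2695680 4 1 0 + mono 492804 3 1 1 + mono 2695680 3 0 2 + mono 2514564 2 0 3 +
      mono 805545 1 0 4,
      mono (-4043520) 3 2 0 + mono (-739206) 2 2 1 + mono (-5391360) 2 1 2 +
      mono (-3234816) 1 1 3 + mono (-1347840) 1 0 4 + mono (-1279395) 0 1 4 +
      mono (-473850) 0 0 5,
      mono 113724 2 1 2 + mono 113724 1 0 4 + mono 142155 0 0 5],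
    ![mono (-4259840) 4 1 0 + mono (-492804) 3 2 0 + mono (-1769472) 3 1 1 +
      mono (-4259840) 3 0 2 + mono 1891836 2 1 2 + mono (-4964352) 2 0 3 + mono (-805545) 1 1 3 +
      mono (-2949120) 1 0 4,
      mono 6389760 3 2 0 + mono 739206 2 3 0 + mono 1410048 2 2 1 + mono 8519680 2 1 2 +
      mono (-3763584) 1 2 2 + mono 4604928 1 1 3 + mono 2129920 1 0 4 + mono 1279395 0 2 3 +
      mono 473850 0 1 4,
      mono 622080 3 2 0 + mono (-113724) 2 2 1 + mono 1064448 2 1 2 + mono 663876 1 1 3 +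
      mono 442368 1 0 4 + mono (-142155) 0 1 4]]

/-- Generators of the Jacobian syzygies of the fiber over `b'`. -/
noncomputable def syzygiesB' : Fin 3 → Fin 3 → Form :=
  ![![mono (-3294720) 3 2 0 + mono (-642318336) 3 1 1 + mono 64829952 2 1 2 +
      mono (-642318336) 2 0 3 + mono (-5385600) 1 1 3 + mono (-316293120) 1 0 4 +
      mono 14417920 0 0 5,
      mono 4942080 2 3 0 + mono 963477504 2 2 1 + mono (-94076928) 1 2 2 +
      mono 1401421824 1 1 3 + mono 8553600 0 2 3 + mono 327571200 0 1 4 + mono 437944320 0 0 5,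
      mono (-760320) 2 2 1 + mono (-58392576) 2 1 2 + mono 2483712 1 1 3 +
      mono (-58392576) 1 0 4 + mono (-950400) 0 1 4 + mono (-40550400) 0 0 5],
    ![mono 3294720 4 1 0 + mono 91260 3 1 1 + mono 3294720 3 0 2 + mono 2063100 2 0 3 +
      mono 149175 1 0 4,
      mono (-4942080) 3 2 0 + mono (-136890) 2 2 1 + mono (-7188480) 2 1 2 +
      mono (-2620800) 1 1 3 + mono (-2246400) 1 0 4 + mono (-236925) 0 1 4 + mono (-295750) 0 0 5,
      mono 299520 3 1 1 + mono 21060 2 1 2 + mono 299520 2 0 3 + mono 245700 1 0 4 +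
      mono 26325 0 0 5],
    ![mono 642318336 4 1 0 + mono (-91260) 3 2 0 + mono (-68124672) 3 1 1 +
      mono 642318336 3 0 2 + mono 3322500 2 1 2 + mono 316293120 2 0 3 + mono (-149175) 1 1 3 +
      mono (-14417920) 1 0 4,
      mono (-963477504) 3 2 0 + mono 136890 2 3 0 + mono 101265408 2 2 1 +
      mono (-1401421824) 2 1 2 + mono (-5932800) 1 2 2 + mono (-325324800) 1 1 3 +
      mono (-437944320) 1 0 4 + mono 236925 0 2 3 + mono 295750 0 1 4,
      mono 460800 3 2 0 + mono 58392576 3 1 1 + mono (-21060) 2 2 1 + mono (-2783232) 2 1 2 +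
      mono 58392576 2 0 3 + mono 704700 1 1 3 + mono 40550400 1 0 4 + mono (-26325) 0 1 4]]

/-- Generators of the Jacobian syzygies of the fiber over `1`. -/
noncomputable def syzygiesOne : Fin 3 → Fin 3 → Form :=
  ![![mono (-108210600) 4 1 0 + mono (-42120) 3 2 0 + mono (-25302316) 3 1 1 +
      mono (-108210600) 3 0 2 + mono (-1081728) 2 1 2 + mono (-52354966) 2 0 3 +
      mono (-68850) 1 1 3 + mono (-12547335) 1 0 4 + mono (-128880) 0 0 5,
      mono 162315900 3 2 0 + mono 63180 2 3 0 + mono 37953474 2 2 1 + mono 216421200 2 1 2 +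
      mono 1663092 1 2 2 + mono 54634544 1 1 3 + mono 54105300 1 0 4 + mono 109350 0 2 3 +
      mono 14562885 0 1 4 + mono (-10371580) 0 0 5,
      mono (-9720) 2 2 1 + mono (-2014956) 2 1 2 + mono (-77868) 1 1 3 + mono (-2014956) 1 0 4 +
      mono (-12150) 0 1 4 + mono (-1579365) 0 0 5],
    ![mono (-6463583800) 4 1 0 + mono (-985608) 3 2 0 + mono (-1281481668) 3 1 1 +
      mono (-6463583800) 3 0 2 + mono (-36842040) 2 1 2 + mono (-3063489618) 2 0 3 +
      mono (-1611090) 1 1 3 + mono (-692159373) 1 0 4,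
      mono 9695375700 3 2 0 + mono 1478412 2 3 0 + mono 1929182022 2 2 1 +
      mono 12927167600 2 1 2 + mono 64040220 1 2 2 + mono 3066763152 1 1 3 +
      mono 3231791900 1 0 4 + mono 2558790 0 2 3 + mono 868080807 0 1 4 + mono (-644426820) 0 0 5,
      mono (-3479760) 3 2 0 + mono (-227448) 2 2 1 + mono (-127315908) 2 1 2 +
      mono (-6624180) 1 1 3 + mono (-123836148) 1 0 4 + mono (-284310) 0 1 4 +
      mono (-96664023) 0 0 5],
    ![mono (-104400) 5 1 0 + mono (-15584) 4 1 1 + mono (-104400) 4 0 2 + mono 468 3 1 2 +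
      mono (-41684) 3 0 3 + mono (-7980) 2 0 4 + mono 765 1 0 5,
      mono 156600 4 2 0 + mono 23376 3 2 1 + mono 208800 3 1 2 + mono (-702) 2 2 2 +
      mono 35056 2 1 3 + mono 52200 2 0 4 + mono 10050 1 1 4 + mono (-14420) 1 0 5 +
      mono (-1215) 0 1 5 + mono 900 0 0 6,
      mono (-1944) 3 1 2 + mono 108 2 1 3 + mono (-1944) 2 0 4 + mono (-1350) 1 0 5 +
      mono 135 0 0 6]]

/-- `81` times the equation of the fiber over `T / 81`. -/
noncomputable def integralForm (T : ℤ) : Form :=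
  81 * ((X 0 * (X 0 * X 1 + X 2 ^ 2) + X 2 ^ 3) ^ 2 *
      ((X 0 * X 1 + X 2 ^ 2) ^ 2 + X 1 * X 2 ^ 3))
    - 63 * ((X 0 * (X 0 * X 1 + X 2 ^ 2) + X 2 ^ 3) * (X 0 * X 1 + X 2 ^ 2) * X 2 ^ 5)
    + 9 * ((X 0 * X 1 + X 2 ^ 2) * X 2 ^ 8) - (T : Form) * X 2 ^ 10

theorem C_mul_fiberForm {t : ℂ} {T : ℤ} (h : 81 * t = T) :
    C 81 * fiberForm t = integralForm T := by
  have h7 : C 81 * C (7 / 9 : ℂ) = (63 : Form) := by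
    rw [← C_mul, ← map_ofNat C 63]; norm_num
  have h1 : C 81 * C (1 / 9 : ℂ) = (9 : Form) := by
    rw [← C_mul, ← map_ofNat C 9]; norm_num
  have ht : C 81 * C t = (T : Form) := by
    rw [← C_mul, h, map_intCast]
  have h81 : (C 81 : Form) = 81 := map_ofNat C 81
  rw [fiberForm, integralForm, ← h7, ← h1, ← ht, ← h81]
  ring

theorem pderiv_ofNat (i : Fin 3) (n : ℕ) [n.AtLeastTwo] :
    pderiv i (ofNat(n) : Form) = 0 := by
  rw [← map_ofNat C n, pderiv_C]

theorem pderiv_zero_integralForm (T : ℤ) : pderiv 0 (integralForm T) =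
    486 * X 0 ^ 5 * X 1 ^ 4 + 1620 * X 0 ^ 4 * X 1 ^ 3 * X 2 ^ 2 + 972 * X 0 ^ 3 * X 1 ^ 3 *
      X 2 ^ 3 + 1944 * X 0 ^ 3 * X 1 ^ 2 * X 2 ^ 4 + 1755 * X 0 ^ 2 * X 1 ^ 2 * X 2 ^ 5 + 972
      * X 0 ^ 2 * X 1 * X 2 ^ 6 + 486 * X 0 * X 1 ^ 2 * X 2 ^ 6 + 882 * X 0 * X 1 * X 2 ^ 7 +
      162 * X 0 * X 2 ^ 8 + 270 * X 1 * X 2 ^ 8 + 99 * X 2 ^ 9 := by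
  simp only [integralForm, map_add, map_sub, Derivation.leibniz, Derivation.leibniz_pow, pderiv_X,
    pderiv_ofNat, Derivation.map_intCast, smul_eq_mul]
  simp
  ring

theorem pderiv_one_integralForm (T : ℤ) : pderiv 1 (integralForm T) =
    324 * X 0 ^ 6 * X 1 ^ 3 + 972 * X 0 ^ 5 * X 1 ^ 2 * X 2 ^ 2 + 729 * X 0 ^ 4 * X 1 ^ 2 *
      X 2 ^ 3 + 972 * X 0 ^ 4 * X 1 * X 2 ^ 4 + 1170 * X 0 ^ 3 * X 1 * X 2 ^ 5 + 324 * X 0 ^ 3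
      * X 2 ^ 6 + 486 * X 0 ^ 2 * X 1 * X 2 ^ 6 + 441 * X 0 ^ 2 * X 2 ^ 7 + 270 * X 0 * X 2 ^
      8 + 81 * X 2 ^ 9 := by
  simp only [integralForm, map_add, map_sub, Derivation.leibniz, Derivation.leibniz_pow, pderiv_X,
    pderiv_ofNat, Derivation.map_intCast, smul_eq_mul]
  simp
  ring

theorem pderiv_two_integralForm (T : ℤ) : pderiv 2 (integralForm T) =
    648 * X 0 ^ 5 * X 1 ^ 3 * X 2 + 729 * X 0 ^ 4 * X 1 ^ 3 * X 2 ^ 2 + 1944 * X 0 ^ 4 * X 1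
      ^ 2 * X 2 ^ 3 + 2925 * X 0 ^ 3 * X 1 ^ 2 * X 2 ^ 4 + 1944 * X 0 ^ 3 * X 1 * X 2 ^ 5 +
      1458 * X 0 ^ 2 * X 1 ^ 2 * X 2 ^ 5 + 3087 * X 0 ^ 2 * X 1 * X 2 ^ 6 + 648 * X 0 ^ 2 * X
      2 ^ 7 + 2160 * X 0 * X 1 * X 2 ^ 7 + 891 * X 0 * X 2 ^ 8 + 729 * X 1 * X 2 ^ 8 + 270 * X
      2 ^ 9 - 10 * (T : Form) * X 2 ^ 9 := by
  simp only [integralForm, map_add, map_sub, Derivation.leibniz, Derivation.leibniz_pow, pderiv_X,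
    pderiv_ofNat, Derivation.map_intCast, smul_eq_mul]
  simp
  ring

/-! ### Verification of the three resolutions -/

/-- σ models the quotient by h₂ inside S itself: v ≡ σ(v) modulo h₂ and σ(h₂) = 0, so h₂ divides v
exactly when σ(v) = 0. Regularity thus reduces to σ(h₁) ≠ 0 and to a divisibility between the images
of h₀ and h₁. -/
theorem isHilbertBurch_of_retraction {f : Form} {ρ : Fin 3 → Fin 3 → Form} {h : Fin 3 → Form}
    (σ : Form →ₐ[ℂ] Form) (hσ : ∀ i, h 2 ∣ X i - σ (X i)) (hσ2 : σ (h 2) = 0)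
    (hσ1 : σ (h 1) ≠ 0) (h2 : h 2 ≠ 0)
    (hdvd : ∀ a b, a * σ (h 0) + b * σ (h 1) = 0 → σ (h 1) ∣ a)
    (rel : ∀ i, h 0 * ρ 0 i + h 1 * ρ 1 i + h 2 * ρ 2 i = 0)
    (cross : ∃ κ : ℂ, κ ≠ 0 ∧
      ρ 0 1 * ρ 1 2 - ρ 0 2 * ρ 1 1 = C κ * h 2 * pderiv 0 f ∧
      ρ 0 2 * ρ 1 0 - ρ 0 0 * ρ 1 2 = C κ * h 2 * pderiv 1 f ∧
      ρ 0 0 * ρ 1 1 - ρ 0 1 * ρ 1 0 = C κ * h 2 * pderiv 2 f) : IsHilbertBurch f ρ h := by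
  have hv : ∀ v, h 2 ∣ v - σ v := by
    intro v
    induction v using MvPolynomial.induction_on with
    | C r => rw [← algebraMap_eq, AlgHom.commutes, sub_self]; exact dvd_zero _
    | add a b ha hb =>
      have := dvd_add ha hb
      rwa [map_add, add_sub_add_comm]
    | mul_X a i ha =>
      obtain ⟨c, hc⟩ := ha
      obtain ⟨d, hd⟩ := hσ i
      exact ⟨c * X i + σ a * d, by rw [map_mul]; linear_combination X i * hc + σ a * hd⟩
  have hd : ∀ v, h 2 ∣ v → σ v = 0 := by
    rintro _ ⟨c, rfl⟩
    rw [map_mul, hσ2, zero_mul]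
  refine ⟨rel, cross, h2, fun a ha => ?_, fun a b hab => ?_⟩
  · have := hd _ ha
    rw [map_mul] at this
    have := (mul_eq_zero.1 this).resolve_right hσ1
    simpa [this] using hv a
  · have := hd _ hab
    rw [map_add, map_mul, map_mul] at this
    obtain ⟨c, hc⟩ := hdvd _ _ this
    obtain ⟨d, hd⟩ := hv a
    obtain ⟨e, he⟩ := hv (h 1)
    exact ⟨c, d - c * e, by linear_combination hd + hc - c * he⟩

theorem X_zero_prime : Prime (X 0 : Form) := X_prime

theorem X_one_prime : Prime (X 1 : Form) := X_prime

/-- Three generators with the relation `x ρ₀ + y ρ₁ + z ρ₂ = 0`. -/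
theorem isHilbertBurch_of_coordinate_relation {f : Form} {ρ : Fin 3 → Fin 3 → Form}
    (rel : ∀ i, X 0 * ρ 0 i + X 1 * ρ 1 i + X 2 * ρ 2 i = 0)
    (cross : ∃ κ : ℂ, κ ≠ 0 ∧
      ρ 0 1 * ρ 1 2 - ρ 0 2 * ρ 1 1 = C κ * X 2 * pderiv 0 f ∧
      ρ 0 2 * ρ 1 0 - ρ 0 0 * ρ 1 2 = C κ * X 2 * pderiv 1 f ∧
      ρ 0 0 * ρ 1 1 - ρ 0 1 * ρ 1 0 = C κ * X 2 * pderiv 2 f) : IsHilbertBurch f ρ X := by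
  refine isHilbertBurch_of_retraction (aeval ![X 0, X 1, 0]) (fun i => ?_) (by simp)
    (by simp) (X_ne_zero _) (fun a b hab => ?_) rel cross
  · fin_cases i <;> simp
  · simp only [aeval_X, Matrix.cons_val_zero, Matrix.cons_val_one] at hab ⊢
    refine (X_one_prime.dvd_or_dvd (a := a) (b := X 0)
      ⟨-b, by linear_combination hab⟩).resolve_right ?_
    rintro ⟨q, hq⟩
    have := congrArg (eval ![1, 0, 0]) hq
    simp at this

/-- Clearing denominators leaves polynomial identities over ℤ; the factor 81 is absorbed into the
constant. -/
theorem cross_of_integral {f : Form} {ρ : Fin 3 → Fin 3 → Form} {h : Form} {T κ : ℤ} {t : ℂ}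
    (hT : 81 * t = T) (hf : f = fiberForm t) (hκ : κ ≠ 0)
    (c0 : ρ 0 1 * ρ 1 2 - ρ 0 2 * ρ 1 1 = (κ : Form) * h * pderiv 0 (integralForm T))
    (c1 : ρ 0 2 * ρ 1 0 - ρ 0 0 * ρ 1 2 = (κ : Form) * h * pderiv 1 (integralForm T))
    (c2 : ρ 0 0 * ρ 1 1 - ρ 0 1 * ρ 1 0 = (κ : Form) * h * pderiv 2 (integralForm T)) :
    ∃ κ : ℂ, κ ≠ 0 ∧
      ρ 0 1 * ρ 1 2 - ρ 0 2 * ρ 1 1 = C κ * h * pderiv 0 f ∧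
      ρ 0 2 * ρ 1 0 - ρ 0 0 * ρ 1 2 = C κ * h * pderiv 1 f ∧
      ρ 0 0 * ρ 1 1 - ρ 0 1 * ρ 1 0 = C κ * h * pderiv 2 f := by
  have e : ∀ i, (κ : Form) * h * pderiv i (integralForm T) =
      C (κ * 81 : ℂ) * h * pderiv i f := by
    intro i
    rw [← C_mul_fiberForm hT, pderiv_C_mul, C_mul, hf]
    simp only [map_intCast]
    ring
  exact ⟨κ * 81, mul_ne_zero (by exact_mod_cast hκ) (by norm_num), c0.trans (e 0),
    c1.trans (e 1), c2.trans (e 2)⟩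

theorem isHomogeneous_syzygiesZero (j i : Fin 3) : (syzygiesZero j i).IsHomogeneous 5 := by
  fin_cases j <;> fin_cases i <;> repeat' apply IsHomogeneous.add
  all_goals exact isHomogeneous_mono _ _ _ _

theorem isHomogeneous_syzygiesB' (j i : Fin 3) : (syzygiesB' j i).IsHomogeneous 5 := by
  fin_cases j <;> fin_cases i <;> repeat' apply IsHomogeneous.add
  all_goals exact isHomogeneous_mono _ _ _ _

theorem isHomogeneous_syzygiesOne (j i : Fin 3) :
    (syzygiesOne j i).IsHomogeneous (![5, 5, 6] j) := by
  fin_cases j <;> fin_cases i <;> repeat' apply IsHomogeneous.add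
  all_goals exact isHomogeneous_mono _ _ _ _

theorem isHilbertBurch_zero : IsHilbertBurch (fiberForm 0) syzygiesZero X := by
  refine isHilbertBurch_of_coordinate_relation (fun i => ?_)
    (cross_of_integral (T := 0) (κ := -5175705600) (by simp) rfl (by norm_num) ?_ ?_ ?_)
  · fin_cases i <;> simp only [syzygiesZero, mono, Fin.mk_zero, Fin.mk_one, Fin.reduceFinMk,
      Matrix.cons_val_zero, Matrix.cons_val_one, Matrix.cons_val] <;> push_cast <;> ring
  · rw [pderiv_zero_integralForm]
    simp only [syzygiesZero, mono, Matrix.cons_val_zero, Matrix.cons_val_one, Matrix.cons_val]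
    push_cast
    ring
  · rw [pderiv_one_integralForm]
    simp only [syzygiesZero, mono, Matrix.cons_val_zero, Matrix.cons_val_one, Matrix.cons_val]
    push_cast
    ring
  · rw [pderiv_two_integralForm]
    simp only [syzygiesZero, mono, Matrix.cons_val_zero, Matrix.cons_val_one]
    push_cast
    ring

theorem isHilbertBurch_b' : IsHilbertBurch (fiberForm b') syzygiesB' X := by
  refine isHilbertBurch_of_coordinate_relation (fun i => ?_)
    (cross_of_integral (T := -64) (κ := -4685824000) (by rw [b']; norm_num) rfl (by norm_num) ?_ ?_ ?_)
  · fin_cases i <;> simp only [syzygiesB', mono, Fin.mk_zero, Fin.mk_one, Fin.reduceFinMk,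
      Matrix.cons_val_zero, Matrix.cons_val_one, Matrix.cons_val] <;> push_cast <;> ring
  · rw [pderiv_zero_integralForm]
    simp only [syzygiesB', mono, Matrix.cons_val_zero, Matrix.cons_val_one, Matrix.cons_val]
    push_cast
    ring
  · rw [pderiv_one_integralForm]
    simp only [syzygiesB', mono, Matrix.cons_val_zero, Matrix.cons_val_one, Matrix.cons_val]
    push_cast
    ring
  · rw [pderiv_two_integralForm]
    simp only [syzygiesB', mono, Matrix.cons_val_zero, Matrix.cons_val_one]
    push_cast
    ring

/-- The binary quadrics `x (α x + β z)` and `z (13050 x + 895 z)` have no common factor. -/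
theorem dvd_of_quadrics (a b : Form)
    (h : a * (X 0 * (-4671900 * X 0 - 1002754 * X 2)) + b * (X 2 * (13050 * X 0 + 895 * X 2)) = 0) :
    13050 * X 0 ^ 1 * X 1 ^ 0 * X 2 ^ 1 + 895 * X 0 ^ 0 * X 1 ^ 0 * X 2 ^ 2 ∣ a := by
  obtain ⟨a', rfl⟩ : X 2 ∣ a := by
    refine (X_two_prime.dvd_or_dvd (a := a) (b := X 0 * (-4671900 * X 0 - 1002754 * X 2))
      ⟨-(b * (13050 * X 0 + 895 * X 2)), by linear_combination h⟩).resolve_right ?_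
    rintro ⟨q, hq⟩
    have := congrArg (eval ![1, 0, 0]) hq
    simp at this
  have h' : a' * (X 0 * (-4671900 * X 0 - 1002754 * X 2)) + b * (13050 * X 0 + 895 * X 2) = 0 :=
    mul_left_cancel₀ X_two_prime.ne_zero (by linear_combination h)
  obtain ⟨b', rfl⟩ : X 0 ∣ b := by
    refine (X_zero_prime.dvd_or_dvd (a := b) (b := 13050 * X 0 + 895 * X 2)
      ⟨-(a' * (-4671900 * X 0 - 1002754 * X 2)), by linear_combination h'⟩).resolve_right ?_
    rintro ⟨q, hq⟩
    have := congrArg (eval ![0, 0, 1]) hq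
    simp at this
  have h'' : a' * (-4671900 * X 0 - 1002754 * X 2) + b' * (13050 * X 0 + 895 * X 2) = 0 :=
    mul_left_cancel₀ X_zero_prime.ne_zero (by linear_combination h')
  -- Since 4671900 = 358 · 13050 and 1002754 = 358 · 895 + 682344, the first linear form is -358
  -- times the second minus 682344 z.
  have hk : (C (1 / 682344) : Form) * 682344 = 1 := by
    rw [← map_ofNat C 682344, ← C_mul, ← C_1]; norm_num
  have hz : X 2 * a' = (13050 * X 0 + 895 * X 2) *
      (C (1 / 682344) * (b' - 358 * a')) := by
    linear_combination -C (1 / 682344) * h'' - (X 2 * a') * hk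
  obtain ⟨c, hc⟩ : X 2 ∣ C (1 / 682344) * (b' - 358 * a') := by
    refine (X_two_prime.dvd_or_dvd ⟨a', hz.symm⟩).resolve_left ?_
    rintro ⟨q, hq⟩
    have := congrArg (eval ![1, 0, 0]) hq
    simp at this
  refine ⟨c, ?_⟩
  rw [hz, hc]
  ring

/-- The relation between the generators over `1`. -/
noncomputable def relationOne : Fin 3 → Form :=
  ![mono (-4671900) 2 0 0 + mono (-1002754) 1 0 1, mono 13050 1 0 1 + mono 895 0 0 2,
    mono 4842424350 1 0 0 + mono 1884870 0 1 0 + mono 640846671 0 0 1]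

theorem isHomogeneous_relationOne (j : Fin 3) :
    (relationOne j).IsHomogeneous (7 - ![5, 5, 6] j) := by
  fin_cases j <;> repeat' apply IsHomogeneous.add
  all_goals exact isHomogeneous_mono _ _ _ _

theorem isHilbertBurch_one : IsHilbertBurch (fiberForm 1) syzygiesOne relationOne := by
  have hy : (C (1 / 1884870) : Form) * 1884870 = 1 := by
    rw [← map_ofNat C 1884870, ← C_mul, ← C_1]; norm_num
  refine isHilbertBurch_of_retraction
    -- The retraction solves the linear equation h₂ = 0 for y. It fixes h₀ and h₁, which do not
    -- involve y.
    (aeval ![X 0, -C (1 / 1884870) * (4842424350 * X 0 + 640846671 * X 2), X 2])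
    (fun i => ?_) ?_ ?_ ?_ (fun a b hab => ?_) (fun i => ?_)
    (cross_of_integral (T := 81) (κ := -240) (by simp) rfl (by norm_num) ?_ ?_ ?_)
  · fin_cases i <;> simp only [relationOne, mono, Fin.mk_zero, Fin.mk_one, Fin.reduceFinMk,
      Matrix.cons_val_zero, Matrix.cons_val_one, Matrix.cons_val, aeval_X, sub_self, dvd_zero]
    refine ⟨C (1 / 1884870), ?_⟩
    push_cast
    linear_combination (-X 1) * hy
  · simp only [relationOne, mono, Matrix.cons_val, map_add, map_mul, map_pow, map_intCast,
      aeval_X, Matrix.cons_val_zero, Matrix.cons_val_one]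
    push_cast
    linear_combination (-(4842424350 * X 0 + 640846671 * X 2)) * hy
  · simp only [relationOne, mono, Matrix.cons_val, map_add, map_mul, map_pow, map_intCast,
      aeval_X, Matrix.cons_val_zero, Matrix.cons_val_one]
    intro h
    have := congrArg (eval ![1, 0, 1]) h
    simp at this
    norm_num at this
  · intro h
    have := congrArg (eval ![1, 0, 0]) h
    simp [relationOne, mono] at this
  · simp only [relationOne, mono, Matrix.cons_val, map_add, map_mul, map_pow, map_intCast,
      aeval_X, Matrix.cons_val_zero, Matrix.cons_val_one] at hab ⊢
    push_cast at hab ⊢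
    exact dvd_of_quadrics a b (by linear_combination hab)
  · fin_cases i <;> simp only [syzygiesOne, relationOne, mono, Fin.mk_zero, Fin.mk_one, Fin.reduceFinMk,
      Matrix.cons_val_zero, Matrix.cons_val_one, Matrix.cons_val] <;> push_cast <;> ring
  · rw [pderiv_zero_integralForm]
    simp only [syzygiesOne, relationOne, mono, Matrix.cons_val_zero, Matrix.cons_val_one, Matrix.cons_val]
    push_cast
    ring
  · rw [pderiv_one_integralForm]
    simp only [syzygiesOne, relationOne, mono, Matrix.cons_val_zero, Matrix.cons_val_one, Matrix.cons_val]
    push_cast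
    ring
  · rw [pderiv_two_integralForm]
    simp only [syzygiesOne, relationOne, mono, Matrix.cons_val_zero, Matrix.cons_val_one, Matrix.cons_val]
    push_cast
    ring

end PlaneCurve

namespace PlaneCurve
open MvPolynomial

/-! ### Exponents and total Tjurina numbers of the fibers -/

theorem pderiv_zero_fiberForm_ne_zero {t : ℂ} {T : ℤ} (h : 81 * t = T) :
    pderiv 0 (fiberForm t) ≠ 0 := by
  intro h0
  have h1 := pderiv_zero_integralForm T
  rw [← C_mul_fiberForm h, pderiv_C_mul, h0] at h1
  have := congrArg (eval ![1, 1, 0]) h1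
  simp at this

theorem isReducedCurve_fiberForm {t : ℂ} (h : Prime (fiberForm t)) :
    IsReducedCurve (fiberForm t) 10 :=
  ⟨isHomogeneous_fiberForm t, h.irreducible.squarefree⟩

theorem choose_two_mul_two (n : ℕ) : (n + 2).choose 2 * 2 = (n + 2) * (n + 1) := by
  rw [Nat.choose_two_right, Nat.add_sub_assoc (by norm_num)]
  exact Nat.div_mul_cancel (even_iff_two_dvd.1 (Nat.even_mul_pred_self _))

theorem monotone_exponents {a b c : ℕ} (h₁ : a ≤ b) (h₂ : b ≤ c) : Monotone ![a, b, c] := by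
  intro i j hij
  fin_cases i <;> fin_cases j <;> simp at hij ⊢ <;> omega

theorem isNearlyFree_fiberForm {t : ℂ} {T : ℤ} {ρ : Fin 3 → Fin 3 → Form} (hT : 81 * t = T)
    (hp : Prime (fiberForm t)) (H : IsHilbertBurch (fiberForm t) ρ X)
    (hρ : ∀ j i, (ρ j i).IsHomogeneous 5) :
    IsNearlyFree (fiberForm t) 10 5 5 ∧ HasTotalTjurinaNumber (fiberForm t) 60 := by
  have hd : ∀ j, (![5, 5, 5] : Fin 3 → ℕ) j = 5 := by intro j; fin_cases j <;> rfl
  have h0 := pderiv_zero_fiberForm_ne_zero hT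
  refine ⟨⟨isReducedCurve_fiberForm hp, H.hasExponents hp (isHomogeneous_fiberForm t) h0
    (monotone_exponents le_rfl le_rfl) (fun j i => by rw [hd]; exact hρ j i) (fun j => by simp),
    rfl⟩, ?_⟩
  filter_upwards [Filter.eventually_ge_atTop 15] with k hk
  -- The partials have degree D = 9, and the relation, linear on generators of degree 5, sits in
  -- degree e = 6.
  obtain ⟨n, rfl⟩ : ∃ n, k = n + 6 + 9 := ⟨k - 15, by omega⟩
  have := H.finrank_milnorAlgebraPart (D := 9) (e := 6) (n := n) hp (isHomogeneous_fiberForm t) h0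
    (d := fun _ => 5) (by simp) hρ (isHomogeneous_X ℂ)
  rw [Fin.sum_univ_three] at this
  have e1 := choose_two_mul_two n
  have e2 := choose_two_mul_two (n + 6)
  have e3 := choose_two_mul_two (n + 6 + 9)
  have e4 := choose_two_mul_two (n + 6 - 5)
  rw [show n + 6 - 5 = n + 1 by omega] at *
  nlinarith

theorem isMPOG_fiberForm_one :
    IsMPOG (fiberForm 1) 10 5 5 6 ∧ HasTotalTjurinaNumber (fiberForm 1) 59 := by
  have hp := prime_fiberForm_one
  have H := isHilbertBurch_one
  have h0 := pderiv_zero_fiberForm_ne_zero (t := 1) (T := 81) (by simp)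
  refine ⟨⟨⟨isReducedCurve_fiberForm hp, H.hasExponents hp (isHomogeneous_fiberForm 1) h0
    (monotone_exponents le_rfl (by norm_num)) isHomogeneous_syzygiesOne
    (fun j => by fin_cases j <;> simp [relationOne, mono]), rfl⟩, rfl⟩, ?_⟩
  filter_upwards [Filter.eventually_ge_atTop 16] with k hk
  -- Now e = 7, since the relation has degrees 2, 2, 1 on generators of degrees 5, 5, 6.
  obtain ⟨n, rfl⟩ : ∃ n, k = n + 7 + 9 := ⟨k - 16, by omega⟩
  have := H.finrank_milnorAlgebraPart (D := 9) (e := 7) (n := n) hp (isHomogeneous_fiberForm 1) h0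
    (d := ![5, 5, 6]) (by intro j; fin_cases j <;> simp) isHomogeneous_syzygiesOne
    isHomogeneous_relationOne
  rw [Fin.sum_univ_three] at this
  simp only [Matrix.cons_val_zero, Matrix.cons_val_one, Matrix.cons_val] at this
  have e1 := choose_two_mul_two n
  have e2 := choose_two_mul_two (n + 7)
  have e3 := choose_two_mul_two (n + 7 + 9)
  have e4 := choose_two_mul_two (n + 7 - 5)
  have e5 := choose_two_mul_two (n + 7 - 6)
  rw [show n + 7 - 5 = n + 2 by omega] at *
  rw [show n + 7 - 6 = n + 1 by omega] at *
  nlinarith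

theorem isNearlyFree_fiberForm_zero :
    IsNearlyFree (fiberForm 0) 10 5 5 ∧ HasTotalTjurinaNumber (fiberForm 0) 60 :=
  isNearlyFree_fiberForm (T := 0) (by simp) prime_fiberForm_zero isHilbertBurch_zero
    isHomogeneous_syzygiesZero

theorem isNearlyFree_fiberForm_b' :
    IsNearlyFree (fiberForm b') 10 5 5 ∧ HasTotalTjurinaNumber (fiberForm b') 60 :=
  isNearlyFree_fiberForm (T := -64) (by rw [b']; norm_num) prime_fiberForm_b' isHilbertBurch_b'
    isHomogeneous_syzygiesB'

end PlaneCurve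

namespace PlaneCurve
open Polynomial

/-! ### Differentials of hyperelliptic function fields -/

/-- `K = ℂ(p, w)` with `p` transcendental and `w² = q(p)`, where `q` is squarefree. -/
structure IsHyperelliptic {K : Type*} [Field K] [Algebra ℂ K] (p w : K) (q : ℂ[X]) : Prop where
  transcendental : Transcendental ℂ p
  sq_eq : w ^ 2 = aeval p q
  ne_zero : w ≠ 0
  coprime : IsCoprime q (derivative q)
  adjoin_eq_top : IntermediateField.adjoin ℂ {p, w} = ⊤

open TensorProduct in
/-- The differential of a separating transcendental element is a basis of the differentials. -/
theorem exists_equiv_kaehlerDifferential {K : Type*} [Field K] [Algebra ℂ K] {p w : K} {q : ℂ[X]}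
    (H : IsHyperelliptic p w q) : ∃ L : Ω[K⁄ℂ] ≃ₗ[K] K, L (KaehlerDifferential.D ℂ K p) = 1 := by
  let _ : Algebra ℂ[X] K := (aeval p : ℂ[X] →ₐ[ℂ] K).toRingHom.toAlgebra
  have hmap : ∀ a : ℂ[X], algebraMap ℂ[X] K a = aeval p a := fun _ => rfl
  have : IsScalarTower ℂ ℂ[X] K := IsScalarTower.of_algebraMap_eq fun a => by
    rw [hmap, algebraMap_eq, aeval_C]
  have hinj : Function.Injective (algebraMap ℂ[X] K) :=
    transcendental_iff_injective.1 H.transcendental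
  have : FaithfulSMul ℂ[X] K := (faithfulSMul_iff_algebraMap_injective _ _).2 hinj
  let _ : Algebra (FractionRing ℂ[X]) K := FractionRing.liftAlgebra ℂ[X] K
  have : IsScalarTower ℂ[X] (FractionRing ℂ[X]) K := FractionRing.isScalarTower_liftAlgebra _ _
  have : IsScalarTower ℂ (FractionRing ℂ[X]) K := IsScalarTower.of_algebraMap_eq fun a => by
    rw [IsScalarTower.algebraMap_apply ℂ ℂ[X] K, IsScalarTower.algebraMap_apply ℂ[X]
      (FractionRing ℂ[X]) K, ← IsScalarTower.algebraMap_apply ℂ ℂ[X] (FractionRing ℂ[X])]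
  have halg : Algebra.IsAlgebraic (FractionRing ℂ[X]) K := by
    have hp : p = algebraMap (FractionRing ℂ[X]) K (algebraMap ℂ[X] _ X) := by
      rw [← IsScalarTower.algebraMap_apply, hmap, aeval_X]
    have hpa : IsAlgebraic (FractionRing ℂ[X]) p := by
      rw [hp]
      exact isAlgebraic_algebraMap _
    have hwa : IsAlgebraic (FractionRing ℂ[X]) w := by
      refine IsAlgebraic.of_pow (n := 2) (by norm_num) ?_
      rw [H.sq_eq, ← hmap, IsScalarTower.algebraMap_apply ℂ[X] (FractionRing ℂ[X]) K]
      exact isAlgebraic_algebraMap _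
    have hle : IntermediateField.adjoin ℂ {p, w} ≤
        (algebraicClosure (FractionRing ℂ[X]) K).restrictScalars ℂ := by
      rw [IntermediateField.adjoin_le_iff]
      rintro x (rfl | rfl)
      · exact mem_algebraicClosure_iff.2 hpa
      · exact mem_algebraicClosure_iff.2 hwa
    rw [H.adjoin_eq_top] at hle
    exact ⟨fun x => mem_algebraicClosure_iff.1
      ((IntermediateField.mem_restrictScalars ℂ).1 (hle (IntermediateField.mem_top (x := x))))⟩
  -- K is a separable algebraic extension of a localization of ℂ[X], hence formally étale over ℂ[X];
  -- its differentials are K ⊗ Ω[ℂ[X]⁄ℂ], free on dX.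
  have := Algebra.FormallyEtale.of_isSeparable (FractionRing ℂ[X]) K
  have := Algebra.FormallyEtale.of_isLocalization (Rₘ := FractionRing ℂ[X])
    (nonZeroDivisors ℂ[X])
  have : Algebra.FormallyEtale ℂ[X] K := Algebra.FormallyEtale.comp ℂ[X] (FractionRing ℂ[X]) K
  let e := KaehlerDifferential.tensorKaehlerEquivOfFormallyEtale ℂ ℂ[X] K
  refine ⟨e.symm ≪≫ₗ TensorProduct.AlgebraTensorModule.congr (LinearEquiv.refl K K)
    (KaehlerDifferential.polynomialEquiv ℂ) ≪≫ₗ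
    TensorProduct.AlgebraTensorModule.rid ℂ[X] K K, ?_⟩
  have := KaehlerDifferential.tensorKaehlerEquivOfFormallyEtale_symm_D_algebraMap ℂ ℂ[X] K
    (X : ℂ[X])
  rw [hmap, aeval_X] at this
  simp only [LinearEquiv.trans_apply, e, this]
  simp [KaehlerDifferential.polynomialEquiv_D]

namespace IsHyperelliptic

variable {K : Type*} [Field K] [Algebra ℂ K] {p w : K} {q : ℂ[X]}

theorem derivation_w (H : IsHyperelliptic p w q) {d : Derivation ℂ K K} (hd : d p = w) :
    d w = aeval p (derivative q) * algebraMap ℂ K (1 / 2) := by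
  have h := congrArg d H.sq_eq
  rw [Derivation.map_aeval, hd, Derivation.leibniz_pow, smul_eq_mul, smul_eq_mul] at h
  have h2 : (2 : K) * algebraMap ℂ K (1 / 2) = 1 := by
    rw [← map_ofNat (algebraMap ℂ K) 2, ← map_mul]
    norm_num
  have h3 : 2 * d w = aeval p (derivative q) := by
    apply mul_right_cancel₀ H.ne_zero
    rw [← h]
    simp
    ring
  rw [← h3]
  linear_combination -d w * h2

/-- The coordinate ring `ℂ[p, w]`. -/
abbrev coordinateRing (p w : K) : Subalgebra ℂ K := Algebra.adjoin ℂ {p, w}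

theorem p_mem : p ∈ coordinateRing p w := Algebra.subset_adjoin (by simp)

theorem w_mem : w ∈ coordinateRing p w := Algebra.subset_adjoin (by simp)

theorem aeval_mem (a : ℂ[X]) : aeval p a ∈ coordinateRing p w := by
  have := aeval_algHom_apply (coordinateRing p w).val ⟨p, p_mem⟩ a
  simp only [Subalgebra.coe_val] at this
  rw [this]
  exact Subtype.property _

theorem derivation_mem (H : IsHyperelliptic p w q) {d : Derivation ℂ K K} (hd : d p = w) {r : K}
    (hr : r ∈ coordinateRing p w) : d r ∈ coordinateRing p w := by
  induction hr using Algebra.adjoin_induction with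
  | mem x hx =>
    rcases hx with rfl | rfl
    · rw [hd]; exact w_mem
    · rw [H.derivation_w hd]
      exact mul_mem (aeval_mem _) (Subalgebra.algebraMap_mem _ _)
  | algebraMap c => rw [Derivation.map_algebraMap]; exact zero_mem _
  | add x y _ _ hx hy => rw [map_add]; exact add_mem hx hy
  | mul x y hx' hy' hx hy =>
    rw [Derivation.leibniz]
    exact add_mem (mul_mem hx' hy) (mul_mem hy' hx)

theorem exists_eq_add_mul (H : IsHyperelliptic p w q) {r : K} (hr : r ∈ coordinateRing p w) :
    ∃ a b : ℂ[X], r = aeval p a + aeval p b * w := by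
  induction hr using Algebra.adjoin_induction with
  | mem x hx =>
    rcases hx with rfl | rfl
    · exact ⟨X, 0, by simp⟩
    · exact ⟨0, 1, by simp⟩
  | algebraMap c => exact ⟨C c, 0, by simp⟩
  | add x y _ _ hx hy =>
    obtain ⟨a, b, rfl⟩ := hx
    obtain ⟨c, d, rfl⟩ := hy
    exact ⟨a + c, b + d, by simp only [map_add]; ring⟩
  | mul x y _ _ hx hy =>
    obtain ⟨a, b, rfl⟩ := hx
    obtain ⟨c, d, rfl⟩ := hy
    exact ⟨a * c + b * d * q, a * d + b * c, by
      simp only [map_add, map_mul]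
      linear_combination aeval p b * aeval p d * H.sq_eq⟩

/-- The cofactor is normally the conjugate a - bw, and the product the norm a² - b²q. -/
theorem exists_mul_eq_aeval (H : IsHyperelliptic p w q) {r : K} (hr : r ∈ coordinateRing p w)
    (h0 : r ≠ 0) : ∃ r' ∈ coordinateRing p w, ∃ N : ℂ[X], N ≠ 0 ∧ r * r' = aeval p N := by
  obtain ⟨a, b, rfl⟩ := H.exists_eq_add_mul hr
  -- The conjugate can vanish when w lies in ℂ(p), as for w = 1, q = 1. Then r = 2a is already a
  -- polynomial in p.
  by_cases h : aeval p a - aeval p b * w = 0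
  · refine ⟨1, one_mem _, 2 * a, ?_, ?_⟩
    · rintro h2
      have ha : a = 0 := by simpa using h2
      rw [ha, map_zero, zero_sub, neg_eq_zero] at h
      rw [ha, h] at h0
      simp at h0
    · rw [map_mul, map_ofNat]
      linear_combination -h
  · refine ⟨aeval p a - aeval p b * w, sub_mem (aeval_mem _) (mul_mem (aeval_mem _) w_mem),
      a ^ 2 - b ^ 2 * q, ?_, ?_⟩
    · intro hN
      apply mul_ne_zero h0 h
      have := congrArg (aeval p) hN
      rw [map_zero] at this
      rw [← this]
      simp only [map_sub, map_mul, map_pow]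
      linear_combination -aeval p b ^ 2 * H.sq_eq
    · simp only [map_sub, map_mul, map_pow]
      linear_combination -aeval p b ^ 2 * H.sq_eq

theorem exists_eq_div (H : IsHyperelliptic p w q) (b : K) :
    ∃ r ∈ coordinateRing p w, ∃ t ∈ coordinateRing p w, b = r / t := by
  rw [← IntermediateField.mem_adjoin_iff_div, H.adjoin_eq_top]
  exact IntermediateField.mem_top

/-- First-order expansion at (a, c), valid whether or not this point lies on the curve. -/
theorem exists_eq_add_of_root (a c : ℂ) {r : K} (hr : r ∈ coordinateRing p w) :
    ∃ r₀ : ℂ, ∃ r₁ ∈ coordinateRing p w, ∃ r₂ ∈ coordinateRing p w,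
      r = algebraMap ℂ K r₀ + (p - algebraMap ℂ K a) * r₁ + (w - algebraMap ℂ K c) * r₂ := by
  induction hr using Algebra.adjoin_induction with
  | mem x hx =>
    rcases hx with rfl | rfl
    · exact ⟨a, 1, one_mem _, 0, zero_mem _, by ring⟩
    · exact ⟨c, 0, zero_mem _, 1, one_mem _, by ring⟩
  | algebraMap c => exact ⟨c, 0, zero_mem _, 0, zero_mem _, by ring⟩
  | add x y _ _ hx hy =>
    obtain ⟨a₀, a₁, h₁, a₂, h₂, rfl⟩ := hx
    obtain ⟨b₀, b₁, k₁, b₂, k₂, rfl⟩ := hy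
    exact ⟨a₀ + b₀, a₁ + b₁, add_mem h₁ k₁, a₂ + b₂, add_mem h₂ k₂, by rw [map_add]; ring⟩
  | mul x y hx' hy' hx hy =>
    obtain ⟨a₀, a₁, h₁, a₂, h₂, ha⟩ := hx
    obtain ⟨b₀, b₁, k₁, b₂, k₂, hb⟩ := hy
    refine ⟨a₀ * b₀, a₁ * y + algebraMap ℂ K a₀ * b₁, add_mem (mul_mem h₁ hy')
      (mul_mem (Subalgebra.algebraMap_mem _ _) k₁), a₂ * y + algebraMap ℂ K a₀ * b₂,
      add_mem (mul_mem h₂ hy') (mul_mem (Subalgebra.algebraMap_mem _ _) k₂), ?_⟩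
    rw [map_mul]
    linear_combination y * ha + algebraMap ℂ K a₀ * hb

end IsHyperelliptic
end PlaneCurve

namespace PlaneCurve
open Polynomial
namespace IsHyperelliptic

/-! ### Valuation rings that contain p -/

theorem mem_of_sq_mem {K : Type*} [Field K] {A : ValuationSubring K} {x : K} (h : x ^ 2 ∈ A) :
    x ∈ A := by
  rw [← A.valuation_le_one_iff] at h ⊢
  rw [map_pow] at h
  exact (pow_le_one_iff two_ne_zero).1 h

variable {K : Type*} [Field K] [Algebra ℂ K] {p w : K} {q : ℂ[X]} {A : ValuationSubring K}

theorem aeval_mem_valuationSubring (hA : ∀ c, algebraMap ℂ K c ∈ A) (hp : p ∈ A) (a : ℂ[X]) :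
    aeval p a ∈ A := by
  induction a using Polynomial.induction_on' with
  | add a b ha hb => rw [map_add]; exact add_mem ha hb
  | monomial n c => rw [aeval_monomial]; exact mul_mem (hA c) (pow_mem hp n)

theorem w_mem_valuationSubring (H : IsHyperelliptic p w q) (hA : ∀ c, algebraMap ℂ K c ∈ A)
    (hp : p ∈ A) : w ∈ A :=
  mem_of_sq_mem (by rw [H.sq_eq]; exact aeval_mem_valuationSubring hA hp q)

theorem mem_valuationSubring (H : IsHyperelliptic p w q) (hA : ∀ c, algebraMap ℂ K c ∈ A)
    (hp : p ∈ A) {r : K} (hr : r ∈ coordinateRing p w) : r ∈ A := by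
  obtain ⟨a, b, rfl⟩ := H.exists_eq_add_mul hr
  exact add_mem (aeval_mem_valuationSubring hA hp a)
    (mul_mem (aeval_mem_valuationSubring hA hp b) (H.w_mem_valuationSubring hA hp))

theorem valuation_algebraMap (hA : ∀ c, algebraMap ℂ K c ∈ A) {c : ℂ} (hc : c ≠ 0) :
    A.valuation (algebraMap ℂ K c) = 1 := by
  refine le_antisymm ((A.valuation_le_one_iff _).2 (hA c)) ?_
  have h1 := (A.valuation_le_one_iff _).2 (hA c⁻¹)
  rw [map_inv₀, map_inv₀] at h1
  have h0 : A.valuation (algebraMap ℂ K c) ≠ 0 := by simpa using hc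
  exact (inv_le_one₀ (zero_lt_iff.2 h0)).1 h1

/-- A polynomial that does not vanish at the center of `A` is a unit of `A`. -/
theorem valuation_aeval_eq_one (hA : ∀ c, algebraMap ℂ K c ∈ A) (hp : p ∈ A) {a : ℂ}
    (ha : A.valuation (p - algebraMap ℂ K a) < 1) {f : ℂ[X]} (hf : f.eval a ≠ 0) :
    A.valuation (aeval p f) = 1 := by
  obtain ⟨g, hg⟩ := X_sub_C_dvd_sub_C_eval (a := a) (p := f)
  have hg' := congrArg (aeval p) hg
  rw [map_sub, map_mul, map_sub, aeval_C, aeval_C, aeval_X] at hg'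
  have hlt : A.valuation (aeval p f - algebraMap ℂ K (f.eval a)) < 1 := by
    rw [hg', map_mul]
    exact mul_lt_one_of_lt_of_le ha
      ((A.valuation_le_one_iff _).2 (aeval_mem_valuationSubring hA hp g))
  have h1 := valuation_algebraMap hA hf
  rw [← h1] at hlt
  have := A.valuation.map_add_eq_of_lt_right hlt
  rw [sub_add_cancel, h1] at this
  exact this

/-- The case where A has no center at a point of the curve: r divides a nonzero polynomial in p,
which splits into factors p - a, all of them units. -/
theorem valuation_eq_one_of_forall (H : IsHyperelliptic p w q) (hA : ∀ c, algebraMap ℂ K c ∈ A)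
    (hp : p ∈ A) (h : ∀ a, A.valuation (p - algebraMap ℂ K a) = 1) {r : K}
    (hr : r ∈ coordinateRing p w) (h0 : r ≠ 0) : A.valuation r = 1 := by
  obtain ⟨r', hr', N, hN, hrN⟩ := H.exists_mul_eq_aeval hr h0
  have hN1 : A.valuation (aeval p N) = 1 := by
    rw [(IsAlgClosed.splits N).eq_prod_roots, map_mul, aeval_C, map_mul,
      valuation_algebraMap hA (leadingCoeff_ne_zero.2 hN), one_mul]
    generalize N.roots = s
    induction s using Multiset.induction_on with
    | empty => simp
    | cons a s ih =>
      rw [Multiset.map_cons, Multiset.prod_cons, map_mul, map_mul, ih, mul_one, map_sub, aeval_X,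
        aeval_C, h]
  rw [← hrN, map_mul] at hN1
  have h1 := (A.valuation_le_one_iff _).2 (H.mem_valuationSubring hA hp hr)
  have h2 := (A.valuation_le_one_iff _).2 (H.mem_valuationSubring hA hp hr')
  exact eq_one_of_one_le_mul_left h1 h2 hN1.ge

/-- A uniformizer of the local ring of the coordinate ring at the center of `A`. -/
theorem exists_uniformizer (H : IsHyperelliptic p w q) (hA : ∀ c, algebraMap ℂ K c ∈ A)
    (hp : p ∈ A) {a : ℂ} (ha : A.valuation (p - algebraMap ℂ K a) < 1) :
    ∃ τ ∈ coordinateRing p w, ∃ β ∈ coordinateRing p w, ∃ e : ℕ, A.valuation τ < 1 ∧ τ ≠ 0 ∧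
      A.valuation β = 1 ∧ A.valuation (p - algebraMap ℂ K a) = A.valuation τ ^ e ∧
      ∀ r ∈ coordinateRing p w, A.valuation r < 1 → ∃ r' ∈ coordinateRing p w, β * r = τ * r' := by
  have hpa0 : p - algebraMap ℂ K a ≠ 0 := by
    intro h
    rw [sub_eq_zero] at h
    exact H.transcendental (h ▸ isAlgebraic_algebraMap a)
  have hpam : p - algebraMap ℂ K a ∈ coordinateRing p w :=
    sub_mem p_mem (Subalgebra.algebraMap_mem _ _)
  have hwA := (A.valuation_le_one_iff _).2 (H.w_mem_valuationSubring hA hp)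
  obtain ⟨q₁, hq₁⟩ := X_sub_C_dvd_sub_C_eval (a := a) (p := q)
  have hq' := congrArg (aeval p) hq₁
  rw [map_sub, map_mul, map_sub, aeval_C, aeval_C, aeval_X, ← H.sq_eq] at hq'
  have hreduce : ∀ (c : ℂ), A.valuation (w - algebraMap ℂ K c) < 1 →
      ∀ r ∈ coordinateRing p w, A.valuation r < 1 → ∃ r₁ ∈ coordinateRing p w,
        ∃ r₂ ∈ coordinateRing p w,
          r = (p - algebraMap ℂ K a) * r₁ + (w - algebraMap ℂ K c) * r₂ := by
    intro c hc r hr hr1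
    obtain ⟨r₀, r₁, h₁, r₂, h₂, rfl⟩ := exists_eq_add_of_root a c hr
    refine ⟨r₁, h₁, r₂, h₂, ?_⟩
    have h3 : A.valuation ((p - algebraMap ℂ K a) * r₁) < 1 := by
      rw [map_mul]
      exact mul_lt_one_of_lt_of_le ha ((A.valuation_le_one_iff _).2 (H.mem_valuationSubring hA hp h₁))
    have h4 : A.valuation ((w - algebraMap ℂ K c) * r₂) < 1 := by
      rw [map_mul]
      exact mul_lt_one_of_lt_of_le hc ((A.valuation_le_one_iff _).2 (H.mem_valuationSubring hA hp h₂))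
    have h5 := A.valuation.map_sub_lt (A.valuation.map_sub_lt hr1 h4) h3
    by_cases h0 : r₀ = 0
    · rw [h0, map_zero, zero_add]
    · exfalso
      rw [add_sub_cancel_right, add_sub_cancel_right, valuation_algebraMap hA h0] at h5
      exact lt_irrefl _ h5
  -- At a branch point w² = (p - a) q₁(p), with q₁(a) ≠ 0 because q is squarefree: w is the
  -- uniformizer and p - a has order e = 2.
  by_cases hqa : q.eval a = 0
  · rw [hqa, map_zero, sub_zero] at hq'
    have hw1 : A.valuation w < 1 := by
      have h : A.valuation w ^ 2 < 1 := by
        rw [← map_pow, hq', map_mul]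
        exact mul_lt_one_of_lt_of_le ha
          ((A.valuation_le_one_iff _).2 (aeval_mem_valuationSubring hA hp q₁))
      exact (pow_lt_one_iff two_ne_zero).1 h
    have hq₁a : q₁.eval a ≠ 0 := by
      intro h
      rw [hqa, map_zero, sub_zero] at hq₁
      obtain ⟨f, g, hfg⟩ := H.coprime
      have := congrArg (Polynomial.eval a) hfg
      rw [hq₁] at this
      simp [h] at this
    have hβ := valuation_aeval_eq_one hA hp ha hq₁a
    refine ⟨w, w_mem, aeval p q₁, aeval_mem q₁, 2, hw1, H.ne_zero, hβ, ?_, fun r hr hr1 => ?_⟩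
    · rw [← map_pow, hq', map_mul, hβ, mul_one]
    · obtain ⟨r₁, h₁, r₂, h₂, rfl⟩ := hreduce 0 (by simpa using hw1) r hr hr1
      refine ⟨w * r₁ + aeval p q₁ * r₂,
        add_mem (mul_mem w_mem h₁) (mul_mem (aeval_mem q₁) h₂), ?_⟩
      rw [map_zero, sub_zero]
      linear_combination -r₁ * hq'
  · obtain ⟨c, hc, hc0⟩ : ∃ c : ℂ, A.valuation (w - algebraMap ℂ K c) < 1 ∧ c ^ 2 = q.eval a := by
      obtain ⟨c, hc⟩ := IsAlgClosed.exists_pow_nat_eq (q.eval a) two_pos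
      have h : A.valuation (w - algebraMap ℂ K c) * A.valuation (w - algebraMap ℂ K (-c)) < 1 := by
        rw [← map_mul, show (w - algebraMap ℂ K c) * (w - algebraMap ℂ K (-c)) =
          (p - algebraMap ℂ K a) * aeval p q₁ by
            rw [← hq', ← hc, map_neg, map_pow]; ring, map_mul]
        exact mul_lt_one_of_lt_of_le ha
          ((A.valuation_le_one_iff _).2 (aeval_mem_valuationSubring hA hp q₁))
      by_cases h1 : A.valuation (w - algebraMap ℂ K c) < 1
      · exact ⟨c, h1, hc⟩
      · refine ⟨-c, ?_, by rw [neg_sq, hc]⟩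
        by_contra h2
        exact absurd h (not_lt.2 (one_le_mul (not_lt.1 h1) (not_lt.1 h2)))
    have hc' : c ≠ 0 := by
      rintro rfl
      exact hqa (by rw [← hc0]; norm_num)
    have hβ : A.valuation (w + algebraMap ℂ K c) = 1 := by
      have h2 := valuation_algebraMap hA (mul_ne_zero two_ne_zero hc')
      have := A.valuation.map_add_eq_of_lt_right (h2.symm ▸ hc)
      rw [h2] at this
      rw [← this, map_mul, map_ofNat]
      congr 1
      ring
    refine ⟨p - algebraMap ℂ K a, hpam, w + algebraMap ℂ K c,
      add_mem w_mem (Subalgebra.algebraMap_mem _ _), 1, ha, hpa0, hβ, (pow_one _).symm,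
      fun r hr hr1 => ?_⟩
    obtain ⟨r₁, h₁, r₂, h₂, rfl⟩ := hreduce c hc r hr hr1
    refine ⟨(w + algebraMap ℂ K c) * r₁ + aeval p q₁ * r₂,
      add_mem (mul_mem (add_mem w_mem (Subalgebra.algebraMap_mem _ _)) h₁)
        (mul_mem (aeval_mem q₁) h₂), ?_⟩
    rw [← hc0, map_pow] at hq'
    linear_combination r₂ * hq'

/-- Every nonzero regular function is a unit times a power of the uniformizer. -/
theorem exists_mul_eq_pow_mul (H : IsHyperelliptic p w q) (hA : ∀ c, algebraMap ℂ K c ∈ A)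
    (hp : p ∈ A) {a : ℂ} (ha : A.valuation (p - algebraMap ℂ K a) < 1) {τ β : K} {e : ℕ}
    (hτ : A.valuation τ < 1) (hτ0 : τ ≠ 0) (hβm : β ∈ coordinateRing p w)
    (hβ : A.valuation β = 1) (he : A.valuation (p - algebraMap ℂ K a) = A.valuation τ ^ e)
    (hdiv : ∀ r ∈ coordinateRing p w, A.valuation r < 1 →
      ∃ r' ∈ coordinateRing p w, β * r = τ * r')
    {r : K} (hr : r ∈ coordinateRing p w) (h0 : r ≠ 0) :
    ∃ n : ℕ, ∃ y ∈ coordinateRing p w, ∃ x ∈ coordinateRing p w, A.valuation x = 1 ∧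
      A.valuation y = 1 ∧ x * r = τ ^ n * y := by
  -- A is not known to be discrete, so termination of division by τ needs an argument. If it never
  -- stopped, r would have arbitrarily high order; but r divides a nonzero polynomial N(p), whose
  -- order is e times the multiplicity of the root a in N.
  by_contra hcon
  have hle : ∀ {x}, x ∈ coordinateRing p w → A.valuation x ≤ 1 := fun hx =>
    (A.valuation_le_one_iff _).2 (H.mem_valuationSubring hA hp hx)
  have hstep : ∀ n : ℕ, ∃ r' ∈ coordinateRing p w, β ^ n * r = τ ^ n * r' := by
    intro n
    induction n with
    | zero => exact ⟨r, hr, by simp⟩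
    | succ n ih =>
      obtain ⟨r', hr', h⟩ := ih
      have hlt : A.valuation r' < 1 := by
        refine lt_of_le_of_ne (hle hr') fun h1 => hcon ?_
        exact ⟨n, r', hr', β ^ n, pow_mem hβm n, by rw [map_pow, hβ, one_pow], h1, h⟩
      obtain ⟨r'', hr'', h'⟩ := hdiv r' hr' hlt
      exact ⟨r'', hr'', by linear_combination β * h + τ ^ n * h'⟩
  obtain ⟨r', hr', N, hN, hrN⟩ := H.exists_mul_eq_aeval hr h0
  obtain ⟨N₁, hN₁, hnd⟩ := exists_eq_pow_rootMultiplicity_mul_and_not_dvd N hN a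
  set k := rootMultiplicity a N
  have hN₁a : N₁.eval a ≠ 0 := fun h => hnd (dvd_iff_isRoot.2 h)
  have hvN : A.valuation (aeval p N) = A.valuation τ ^ (e * k) := by
    rw [hN₁, map_mul, map_pow, map_sub, aeval_X, aeval_C, map_mul, map_pow, he,
      valuation_aeval_eq_one hA hp ha hN₁a, mul_one, pow_mul]
  obtain ⟨r'', hr'', h⟩ := hstep (e * k + 1)
  have hv := congrArg A.valuation h
  rw [map_mul, map_pow, hβ, one_pow, one_mul, map_mul, map_pow] at hv
  have hτv : 0 < A.valuation τ := zero_lt_iff.2 (by simpa using hτ0)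
  rw [← hrN, map_mul, hv] at hvN
  have h1 : A.valuation τ ^ (e * k + 1) * A.valuation r'' * A.valuation r' ≤
      A.valuation τ ^ (e * k + 1) := by
    rw [mul_assoc]
    exact mul_le_of_le_one_right' (mul_le_one' (hle hr'') (hle hr'))
  rw [hvN] at h1
  exact absurd h1 (not_le.2 (pow_lt_pow_right_of_lt_one₀ hτv hτ (Nat.lt_succ_self _)))

/-- The derivation `w d/dp` preserves every valuation ring that contains `p`. -/
theorem derivation_mem_valuationSubring (H : IsHyperelliptic p w q) {d : Derivation ℂ K K}
    (hd : d p = w) (hA : ∀ c, algebraMap ℂ K c ∈ A) (hp : p ∈ A) {b : K} (hb : b ∈ A) :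
    d b ∈ A := by
  -- Once the denominator is a unit of A the quotient rule suffices, since the derivation preserves
  -- ℂ[p, w] ⊆ A. Thus every element of A has to be shown to be such a fraction.
  suffices h : b = 0 ∨ ∃ x ∈ coordinateRing p w, ∃ y ∈ coordinateRing p w, A.valuation y = 1 ∧
      b = x / y by
    rcases h with rfl | ⟨x, hx, y, hy, hy1, rfl⟩
    · rw [map_zero]; exact zero_mem _
    · rw [Derivation.leibniz_div, smul_eq_mul, smul_eq_mul, smul_eq_mul]
      have hyi : y⁻¹ ∈ A := by
        rw [← A.valuation_le_one_iff, map_inv₀, hy1, inv_one]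
      have hm := fun {z} (hz : z ∈ coordinateRing p w) => H.mem_valuationSubring hA hp hz
      exact mul_mem (pow_mem hyi 2) (sub_mem (mul_mem (hm hy) (hm (H.derivation_mem hd hx)))
        (mul_mem (hm hx) (hm (H.derivation_mem hd hy))))
  by_cases hb0 : b = 0
  · exact Or.inl hb0
  right
  obtain ⟨r, hr, t, ht, rfl⟩ := H.exists_eq_div b
  have hr0 : r ≠ 0 := by rintro rfl; simp at hb0
  have ht0 : t ≠ 0 := by rintro rfl; simp at hb0
  by_cases h : ∀ a, A.valuation (p - algebraMap ℂ K a) = 1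
  · exact ⟨r, hr, t, ht, H.valuation_eq_one_of_forall hA hp h ht ht0, rfl⟩
  push Not at h
  obtain ⟨a, ha⟩ := h
  replace ha := lt_of_le_of_ne ((A.valuation_le_one_iff _).2 (sub_mem hp (hA a))) ha
  obtain ⟨τ, hτm, β, hβm, e, hτ, hτ0, hβ, he, hdiv⟩ := H.exists_uniformizer hA hp ha
  obtain ⟨i, y₁, hy₁, x₁, hx₁, vx₁, vy₁, h₁⟩ :=
    H.exists_mul_eq_pow_mul hA hp ha hτ hτ0 hβm hβ he hdiv hr hr0
  obtain ⟨j, y₂, hy₂, x₂, hx₂, vx₂, vy₂, h₂⟩ :=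
    H.exists_mul_eq_pow_mul hA hp ha hτ hτ0 hβm hβ he hdiv ht ht0
  have hne : ∀ {x}, A.valuation x = 1 → x ≠ 0 := by
    rintro x hx rfl
    simp at hx
  have hvr := congrArg A.valuation h₁
  have hvt := congrArg A.valuation h₂
  rw [map_mul, map_mul, vx₁, vy₁, one_mul, mul_one, map_pow] at hvr
  rw [map_mul, map_mul, vx₂, vy₂, one_mul, mul_one, map_pow] at hvt
  have hτv : 0 < A.valuation τ := zero_lt_iff.2 (by simpa using hτ0)
  have hij : j ≤ i := by
    rw [← A.valuation_le_one_iff, map_div₀, hvr, hvt, div_le_one₀ (pow_pos hτv j)] at hb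
    by_contra hlt
    exact absurd hb (not_le.2 (pow_lt_pow_right_of_lt_one₀ hτv hτ (not_le.1 hlt)))
  refine ⟨τ ^ (i - j) * (y₁ * x₂), mul_mem (pow_mem hτm _) (mul_mem hy₁ hx₂), x₁ * y₂,
    mul_mem hx₁ hy₂, by rw [map_mul, vx₁, vy₂, one_mul], ?_⟩
  rw [div_eq_div_iff ht0 (mul_ne_zero (hne vx₁) (hne vy₂))]
  apply mul_left_cancel₀ (pow_ne_zero j hτ0)
  have hpow : τ ^ j * τ ^ (i - j) = τ ^ i := by rw [← pow_add, Nat.add_sub_cancel' hij]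
  linear_combination τ ^ j * y₂ * h₁ - (τ ^ i * y₁) * h₂ - y₁ * x₂ * t * hpow

end IsHyperelliptic
end PlaneCurve

namespace PlaneCurve
open Polynomial

/-! ### Regular differentials of hyperelliptic function fields -/

theorem exists_algebraMap_eq_of_isIntegral {K : Type*} [Field K] [Algebra ℂ K] {x : K}
    (hx : IsIntegral ℂ x) : ∃ c : ℂ, algebraMap ℂ K c = x := by
  have := IsAlgClosed.algebraMap_bijective_of_isIntegral (k := ℂ) (K := integralClosure ℂ K)
  obtain ⟨c, hc⟩ := this.2 ⟨x, hx⟩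
  exact ⟨c, congrArg Subtype.val hc⟩

/-- An element of every valuation ring that contains the constants is constant. -/
theorem exists_algebraMap_eq_of_forall_mem {K : Type*} [Field K] [Algebra ℂ K] {x : K}
    (h : ∀ A : ValuationSubring K, (∀ c, algebraMap ℂ K c ∈ A) → x ∈ A) :
    ∃ c : ℂ, algebraMap ℂ K c = x := by
  refine exists_algebraMap_eq_of_isIntegral ?_
  by_contra hx
  -- The integral closure of ℂ in K is an intersection of valuation rings, and equals ℂ as ℂ is
  -- algebraically closed.
  have : IsIntegrallyClosedIn (integralClosure ℂ K).toSubring K :=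
    Subring.isIntegrallyClosedIn_iff.2 fun {y} hy =>
      isIntegral_trans (A := integralClosure ℂ K) y hy
  obtain ⟨V, hV, hxV⟩ := Subring.exists_le_valuationSubring_of_isIntegrallyClosedIn
    (R := (integralClosure ℂ K).toSubring) hx
  exact hxV (h V fun c => hV (isIntegral_algebraMap (R := ℂ) (x := c)))

theorem mem_regularDifferentials_iff {k K : Type} [Field k] [Field K] [Algebra k K]
    {ω : Ω[K⁄k]} : ω ∈ regularDifferentials k K ↔
      ∀ A : ValuationSubring K, (∀ c, algebraMap k K c ∈ A) →
        ω ∈ Submodule.span k {η | ∃ a ∈ A, ∃ b ∈ A, η = a • KaehlerDifferential.D k K b} := by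
  simp only [regularDifferentials, Submodule.mem_iInf]

namespace IsHyperelliptic

variable {K : Type*} [Field K] [Algebra ℂ K] {p w : K} {q q' : ℂ[X]} {A : ValuationSubring K}

theorem p_ne_zero (H : IsHyperelliptic p w q) : p ≠ 0 := by
  rintro rfl
  exact H.transcendental isAlgebraic_zero

/-- The chart at infinity. -/
theorem reverse (H : IsHyperelliptic p w q) {n : ℕ} (hq' : IsCoprime q' (derivative q'))
    (hw : (w * p⁻¹ ^ n) ^ 2 = aeval p⁻¹ q') : IsHyperelliptic p⁻¹ (w * p⁻¹ ^ n) q' where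
  transcendental h := H.transcendental (by simpa using h.inv)
  sq_eq := hw
  ne_zero := mul_ne_zero H.ne_zero (pow_ne_zero _ (inv_ne_zero H.p_ne_zero))
  coprime := hq'
  adjoin_eq_top := by
    rw [eq_top_iff, ← H.adjoin_eq_top, IntermediateField.adjoin_le_iff]
    have hp : p⁻¹ ∈ IntermediateField.adjoin ℂ {p⁻¹, w * p⁻¹ ^ n} :=
      IntermediateField.subset_adjoin _ _ (by simp)
    have hw : w * p⁻¹ ^ n ∈ IntermediateField.adjoin ℂ {p⁻¹, w * p⁻¹ ^ n} :=
      IntermediateField.subset_adjoin _ _ (by simp)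
    rintro x (rfl | rfl)
    · simpa using inv_mem hp
    · have := div_mem hw (pow_mem hp n)
      rwa [mul_div_cancel_right₀ _ (pow_ne_zero _ (inv_ne_zero H.p_ne_zero))] at this

/-- The coordinate of a differential with respect to the basis `dp / w`. -/
theorem exists_coordinate (H : IsHyperelliptic p w q) :
    ∃ L : Ω[K⁄ℂ] ≃ₗ[K] K, L (KaehlerDifferential.D ℂ K p) = w := by
  obtain ⟨L, hL⟩ := exists_equiv_kaehlerDifferential H
  exact ⟨L ≪≫ₗ LinearEquiv.smulOfNeZero K K w H.ne_zero, by simp [hL]⟩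

/-- L ∘ d is the derivation w d/dp, which preserves A; so the coordinate of a db with respect to
dp/w lies in A. -/
theorem coordinate_mem_of_mem_span (H : IsHyperelliptic p w q) {L : Ω[K⁄ℂ] →ₗ[K] K}
    (hL : L (KaehlerDifferential.D ℂ K p) = w) (hA : ∀ c, algebraMap ℂ K c ∈ A) (hp : p ∈ A)
    {ω : Ω[K⁄ℂ]} (hω : ω ∈ Submodule.span ℂ
      {η | ∃ a ∈ A, ∃ b ∈ A, η = a • KaehlerDifferential.D ℂ K b}) : L ω ∈ A := by
  induction hω using Submodule.span_induction with
  | mem x hx =>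
    obtain ⟨a, ha, b, hb, rfl⟩ := hx
    rw [map_smul, smul_eq_mul]
    exact mul_mem ha (H.derivation_mem_valuationSubring
      (d := L.compDer (KaehlerDifferential.D ℂ K)) hL hA hp hb)
  | zero => rw [map_zero]; exact zero_mem _
  | add x y _ _ hx hy => rw [map_add]; exact add_mem hx hy
  | smul c x _ hx =>
    rw [← algebraMap_smul K c x, map_smul, smul_eq_mul]
    exact mul_mem (hA c) hx

/-- With αq + βq' = 1 and 2w dw = q'(p) dp, one gets dp/w = αw dp + 2β dw. No division by w occurs,
so this also works at branch points. -/
theorem mem_span_of_coordinate_eq_one (H : IsHyperelliptic p w q) {L : Ω[K⁄ℂ] ≃ₗ[K] K}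
    (hL : L (KaehlerDifferential.D ℂ K p) = w) (hA : ∀ c, algebraMap ℂ K c ∈ A) (hp : p ∈ A)
    {ω : Ω[K⁄ℂ]} (hω : L ω = 1) : ω ∈ Submodule.span ℂ
      {η | ∃ a ∈ A, ∃ b ∈ A, η = a • KaehlerDifferential.D ℂ K b} := by
  obtain ⟨α, β, hαβ⟩ := H.coprime
  have hdw : L (KaehlerDifferential.D ℂ K w) = aeval p (derivative q) * algebraMap ℂ K (1 / 2) :=
    H.derivation_w (d := L.toLinearMap.compDer (KaehlerDifferential.D ℂ K)) hL
  have h2 : (2 : K) * algebraMap ℂ K (1 / 2) = 1 := by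
    rw [← map_ofNat (algebraMap ℂ K) 2, ← map_mul]
    norm_num
  have hwA := H.w_mem_valuationSubring hA hp
  have h : ω = (aeval p α * w) • KaehlerDifferential.D ℂ K p +
      (2 * aeval p β) • KaehlerDifferential.D ℂ K w := by
    apply L.injective
    have := congrArg (aeval p) hαβ
    rw [map_add, map_mul, map_mul, map_one, ← H.sq_eq] at this
    rw [hω, map_add, map_smul, map_smul, hL, hdw, smul_eq_mul, smul_eq_mul]
    linear_combination -this - aeval p β * aeval p (derivative q) * h2
  rw [h]
  exact add_mem
    (Submodule.subset_span ⟨_, mul_mem (aeval_mem_valuationSubring hA hp α) hwA, _, hp, rfl⟩)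
    (Submodule.subset_span ⟨_, mul_mem (ofNat_mem A.toSubring 2)
      (aeval_mem_valuationSubring hA hp β), _, hwA, rfl⟩)

/-- The coordinate in the chart at infinity. -/
theorem coordinate_inv (H : IsHyperelliptic p w q) {L : Ω[K⁄ℂ] →ₗ[K] K}
    (hL : L (KaehlerDifferential.D ℂ K p) = w) (n : ℕ) :
    ((-(p⁻¹ ^ n * p ^ 2)) • L) (KaehlerDifferential.D ℂ K p⁻¹) = w * p⁻¹ ^ n := by
  rw [LinearMap.smul_apply, Derivation.leibniz_inv, map_smul, hL]
  simp only [smul_eq_mul]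
  field_simp [H.p_ne_zero]

/-- The form dp/w equals -p^(2 - n) times its analogue d(1/p)/(w/pⁿ) at infinity, where coordinates
of regular differentials lie in A. The bound on n keeps 2 - n from truncating. -/
theorem coordinate_eq_pow_mul (H : IsHyperelliptic p w q) {n : ℕ} (hn : n ≤ 2)
    (H' : IsHyperelliptic p⁻¹ (w * p⁻¹ ^ n) q') {L : Ω[K⁄ℂ] →ₗ[K] K}
    (hL : L (KaehlerDifferential.D ℂ K p) = w) (hA : ∀ c, algebraMap ℂ K c ∈ A) (hp : p⁻¹ ∈ A)
    {ω : Ω[K⁄ℂ]} (hω : ω ∈ Submodule.span ℂ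
      {η | ∃ a ∈ A, ∃ b ∈ A, η = a • KaehlerDifferential.D ℂ K b}) :
    ∃ a ∈ A, L ω = p⁻¹ ^ (2 - n) * a := by
  refine ⟨-((-(p⁻¹ ^ n * p ^ 2)) • L) ω, neg_mem
    (H'.coordinate_mem_of_mem_span (H.coordinate_inv hL n) hA hp hω), ?_⟩
  have h : p⁻¹ ^ (2 - n) * p⁻¹ ^ n * p ^ 2 = 1 := by
    rw [← pow_add, Nat.sub_add_cancel hn, ← mul_pow, inv_mul_cancel₀ H.p_ne_zero, one_pow]
  rw [LinearMap.smul_apply, smul_eq_mul]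
  linear_combination -L ω * h

end IsHyperelliptic

section

variable {K : Type} [Field K] [Algebra ℂ K] {p w : K} {q q' : ℂ[X]}

/-- The coordinate of a regular differential is constant. -/
theorem IsHyperelliptic.exists_coordinate_eq_algebraMap (H : IsHyperelliptic p w q) {n : ℕ}
    (hn : n ≤ 2) (H' : IsHyperelliptic p⁻¹ (w * p⁻¹ ^ n) q') {L : Ω[K⁄ℂ] →ₗ[K] K}
    (hL : L (KaehlerDifferential.D ℂ K p) = w) {ω : Ω[K⁄ℂ]} (hω : ω ∈ regularDifferentials ℂ K) :
    ∃ c : ℂ, algebraMap ℂ K c = L ω := by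
  rw [mem_regularDifferentials_iff] at hω
  refine exists_algebraMap_eq_of_forall_mem fun A hA => ?_
  rcases A.mem_or_inv_mem p with hp | hp
  · exact H.coordinate_mem_of_mem_span hL hA hp (hω A hA)
  · obtain ⟨a, ha, h⟩ := H.coordinate_eq_pow_mul hn H' hL hA hp (hω A hA)
    rw [h]
    exact mul_mem (pow_mem hp _) ha

theorem IsHyperelliptic.rank_regularDifferentials_eq_zero (H : IsHyperelliptic p w q) {n : ℕ}
    (hn : n < 2) (H' : IsHyperelliptic p⁻¹ (w * p⁻¹ ^ n) q') :
    Module.rank ℂ (regularDifferentials ℂ K) = 0 := by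
  obtain ⟨L, hL⟩ := H.exists_coordinate
  rw [rank_zero_iff, Submodule.subsingleton_iff_eq_bot, eq_bot_iff]
  intro ω hω
  obtain ⟨c, hc⟩ := H.exists_coordinate_eq_algebraMap hn.le H' (L := L.toLinearMap) hL hω
  -- A pole of p exists because p is not constant. There c = p^(n - 2) a with a in A, and c ≠ 0
  -- together with n < 2 would put p in A.
  obtain ⟨A, hA, hpA⟩ : ∃ A : ValuationSubring K, (∀ c, algebraMap ℂ K c ∈ A) ∧ p ∉ A := by
    by_contra! h
    obtain ⟨c, hc⟩ := exists_algebraMap_eq_of_forall_mem h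
    exact H.transcendental (hc ▸ isAlgebraic_algebraMap c)
  have hp := (A.mem_or_inv_mem p).resolve_left hpA
  obtain ⟨a, ha, h⟩ := H.coordinate_eq_pow_mul hn.le H' (L := L.toLinearMap) hL hA hp
    (mem_regularDifferentials_iff.1 hω A hA)
  have hc0 : c = 0 := by
    by_contra hc0
    refine hpA ?_
    have h1 : p = algebraMap ℂ K c⁻¹ * (p⁻¹ ^ (1 - n) * a) := by
      have h2 : algebraMap ℂ K c⁻¹ * algebraMap ℂ K c = 1 := by
        rw [← map_mul, inv_mul_cancel₀ hc0, map_one]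
      have h3 : p⁻¹ ^ (2 - n) = p⁻¹ * p⁻¹ ^ (1 - n) := by
        rw [← pow_succ']; congr 1; omega
      rw [← hc, h3] at h
      have h4 := mul_inv_cancel₀ H.p_ne_zero
      linear_combination -p * h2 + p * algebraMap ℂ K c⁻¹ * h +
        algebraMap ℂ K c⁻¹ * p⁻¹ ^ (1 - n) * a * h4
    rw [h1]
    exact mul_mem (hA _) (mul_mem (pow_mem hp _) ha)
  rw [hc0, map_zero] at hc
  rw [Submodule.mem_bot]
  exact L.map_eq_zero_iff.1 hc.symm

theorem IsHyperelliptic.rank_regularDifferentials_eq_one (H : IsHyperelliptic p w q)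
    (H' : IsHyperelliptic p⁻¹ (w * p⁻¹ ^ 2) q') :
    Module.rank ℂ (regularDifferentials ℂ K) = 1 := by
  obtain ⟨L, hL⟩ := H.exists_coordinate
  have hcoord := H.coordinate_inv (L := L.toLinearMap) hL 2
  rw [← mul_pow, inv_mul_cancel₀ H.p_ne_zero, one_pow] at hcoord
  set ω₀ := L.symm 1 with hω₀
  have hL₀ : L ω₀ = 1 := L.apply_symm_apply 1
  have hmem : ω₀ ∈ regularDifferentials ℂ K := by
    rw [mem_regularDifferentials_iff]
    intro A hA
    rcases A.mem_or_inv_mem p with hp | hp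
    · exact H.mem_span_of_coordinate_eq_one hL hA hp hL₀
    -- For n = 2 the two charts give dp/w = -d(1/p)/(w/p²), so the negative of ω₀ has coordinate 1
    -- at infinity.
    · rw [← neg_neg ω₀]
      refine neg_mem (H'.mem_span_of_coordinate_eq_one (L := L ≪≫ₗ LinearEquiv.neg K) ?_ hA hp ?_)
      · simpa using hcoord
      · simp [hL₀]
  have hspan : regularDifferentials ℂ K = Submodule.span ℂ {ω₀} := by
    refine le_antisymm (fun ω hω => ?_) ((Submodule.span_singleton_le_iff_mem _ _).2 hmem)
    obtain ⟨c, hc⟩ := H.exists_coordinate_eq_algebraMap le_rfl H' (L := L.toLinearMap) hL hω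
    refine Submodule.mem_span_singleton.2 ⟨c, L.injective ?_⟩
    rw [← algebraMap_smul K c ω₀, map_smul, hL₀, hc]
    simp
  have h0 : ω₀ ≠ 0 := by
    intro h
    rw [h, map_zero] at hL₀
    exact zero_ne_one hL₀
  rw [hspan, Module.rank_eq_one_iff_finrank_eq_one, finrank_span_singleton h0]

end
end PlaneCurve

namespace PlaneCurve
open MvPolynomial

/-! ### Function fields of plane curves in affine coordinates -/

/-- The coordinate functions `x / z` and `y / z` generate the function field of a plane curve, and
satisfy the affine equation but no equation of smaller degree. -/
theorem exists_generators_functionField {F : Form} {n : ℕ} (hF : F.IsHomogeneous n) (hF0 : F ≠ 0)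
    (hz : ¬ F ∣ X 2) [(Ideal.span {F}).IsPrime] : ∃ ξ η : functionField F,
      IntermediateField.adjoin ℂ {ξ, η} = ⊤ ∧ aeval ![ξ, η] (dehomogenize F) = 0 ∧
      ∀ b : MvPolynomial (Fin 2) ℂ, b ≠ 0 → b.totalDegree < n → aeval ![ξ, η] b ≠ 0 := by
  let L := FractionRing (Form ⧸ Ideal.span {F})
  let π : Form →ₐ[ℂ] L :=
    (IsScalarTower.toAlgHom ℂ (Form ⧸ Ideal.span {F}) L).comp (Ideal.Quotient.mkₐ ℂ _)
  have hπ : ∀ a, π a = algebraMap (Form ⧸ Ideal.span {F}) L (Ideal.Quotient.mk _ a) := fun _ => rfl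
  have hπ0 : ∀ {a}, π a = 0 ↔ F ∣ a := fun {a} => by
    rw [hπ, FaithfulSMul.algebraMap_eq_zero_iff, Ideal.Quotient.eq_zero_iff_mem,
      Ideal.mem_span_singleton]
  have hz0 : π (X 2) ≠ 0 := fun h => hz (hπ0.1 h)
  let v : Fin 2 → L := ![π (X 0) / π (X 2), π (X 1) / π (X 2)]
  have hpow : ∀ (i : Fin 3) (k : ℕ), π (X 2) ^ k * (π (X i) / π (X 2)) ^ k = π (X i) ^ k :=
    fun i k => by rw [← mul_pow, mul_div_cancel₀ _ hz0]
  -- On the curve, a form of degree m is zᵐ times its dehomogenization at (x/z, y/z).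
  have hev : ∀ {a : Form} {m : ℕ}, a.IsHomogeneous m →
      π a = π (X 2) ^ m * aeval v (dehomogenize a) := by
    intro a m ha
    conv_lhs => rw [a.as_sum]
    conv_rhs => rw [a.as_sum]
    rw [map_sum, map_sum, map_sum, Finset.mul_sum]
    refine Finset.sum_congr rfl fun d hd => ?_
    have hdm : d 0 + d 1 + d 2 = m := by
      rw [← degree_eq_of_mem_support ha hd, Finsupp.degree_eq_sum, Fin.sum_univ_three]
    rw [monomial_eq, Finsupp.prod_fintype _ _ (fun _ => pow_zero _), Fin.prod_univ_three, ← hdm]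
    simp only [map_mul, map_pow, dehomogenize_X_zero, dehomogenize_X_one,
      dehomogenize_X_two, one_pow, mul_one, aeval_X, ← algebraMap_eq, AlgHom.commutes]
    simp only [v, Matrix.cons_val_zero, Matrix.cons_val_one]
    rw [pow_add, pow_add, ← hpow 0, ← hpow 1]
    ring
  have hquot : ∀ i, π (X i) / π (X 2) ∈ functionField F := fun i =>
    IntermediateField.subset_adjoin _ _ ⟨1, X i, X 2, isHomogeneous_X ℂ i, isHomogeneous_X ℂ 2,
      by rwa [Ideal.mem_span_singleton], rfl⟩
  let ξ : functionField F := ⟨π (X 0) / π (X 2), hquot 0⟩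
  let η : functionField F := ⟨π (X 1) / π (X 2), hquot 1⟩
  have hval : ∀ b : MvPolynomial (Fin 2) ℂ,
      ((aeval ![ξ, η] b : functionField F) : L) = aeval v b := by
    intro b
    have : (functionField F).val.comp (aeval ![ξ, η]) = aeval v := by
      ext i; fin_cases i <;> simp [v, ξ, η]
    exact DFunLike.congr_fun this b
  refine ⟨ξ, η, ?_, ?_, fun b hb hbn h => ?_⟩
  · apply IntermediateField.map_injective (functionField F).val
    rw [IntermediateField.adjoin_map, ← AlgHom.fieldRange_eq_map, IntermediateField.fieldRange_val]
    refine le_antisymm ?_ ?_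
    · rw [IntermediateField.adjoin_le_iff]
      rintro _ ⟨y, -, rfl⟩
      exact y.2
    · refine (IntermediateField.adjoin_le_iff).2 ?_
      have hmem : ∀ b : MvPolynomial (Fin 2) ℂ, aeval v b ∈
          IntermediateField.adjoin ℂ ((functionField F).val '' {ξ, η}) := by
        intro b
        induction b using MvPolynomial.induction_on with
        | C c => rw [aeval_C]; exact IntermediateField.algebraMap_mem _ _
        | add a b ha hb => rw [map_add]; exact add_mem ha hb
        | mul_X a i ha =>
          rw [map_mul, aeval_X]
          refine mul_mem ha (IntermediateField.subset_adjoin _ _ ?_)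
          fin_cases i
          · exact ⟨ξ, by simp, rfl⟩
          · exact ⟨η, by simp, rfl⟩
      rintro _ ⟨m, a, b, ha, hb, -, rfl⟩
      rw [← hπ, ← hπ, hev ha, hev hb, mul_div_mul_left _ _ (pow_ne_zero _ hz0)]
      exact div_mem (hmem _) (hmem _)
  · apply Subtype.ext
    rw [hval]
    have := hev hF
    rw [hπ0.2 dvd_rfl] at this
    exact (mul_eq_zero.1 this.symm).resolve_left (pow_ne_zero _ hz0)
  -- If b vanished in the function field, F would divide the homogenization of b, a nonzero form of
  -- degree less than n.
  · have hh := isHomogeneous_homogenize b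
    have hb' : homogenize b ≠ 0 := by
      intro h0
      apply hb
      rw [← dehomogenize_homogenize b, h0, map_zero]
    have h1 : π (homogenize b) = 0 := by
      rw [hev hh, dehomogenize_homogenize, ← hval, h]
      simp
    obtain ⟨c, hc⟩ := hπ0.1 h1
    have hc0 : c ≠ 0 := by
      rintro rfl
      exact hb' (by rw [hc, mul_zero])
    have := congrArg totalDegree hc
    rw [totalDegree_mul_of_isDomain hF0 hc0, hF.totalDegree hF0, hh.totalDegree hb'] at this
    omega

section

variable {K : Type*} [Field K] [Algebra ℂ K] {ξ η : K} {t : ℂ}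

/-- The relation between `p` and `s` on the curve `g' = t`. -/
theorem relation_of_aeval_eq_zero (h : aeval ![ξ, η] (g' - C t) = 0) {P S : K}
    (hS : S = ξ * η + 1) (hP : P = ξ * S + 1) :
    9 * P ^ 3 * S ^ 2 - (4 * P - 1) ^ 2 * S - 9 * algebraMap ℂ K t * (P - 1) = 0 := by
  have : CharZero K := charZero_of_injective_algebraMap (algebraMap ℂ K).injective
  simp only [g', p, u, s, map_sub, map_add, map_mul, map_pow, aeval_X, aeval_C, map_one,
    Matrix.cons_val_zero, Matrix.cons_val_one, map_div₀, map_ofNat] at h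
  rw [← hS, ← hP] at h
  have hx : ξ * S = P - 1 := by rw [hP]; ring
  have hy : ξ * η = S - 1 := by rw [hS]; ring
  linear_combination 9 * ξ * S * h - (9 * P ^ 2 * S ^ 2 - 7 * P * S + S) * hx
    - 9 * P ^ 2 * S * hy + 9 * algebraMap ℂ K t * hx

theorem adjoin_eq_top_of_mem (hgen : IntermediateField.adjoin ℂ {ξ, η} = ⊤) {P S : K}
    (hS : S = ξ * η + 1) (hP : P = ξ * S + 1) (hξ : ξ ≠ 0) (hS0 : S ≠ 0)
    {E : IntermediateField ℂ K} (hPE : P ∈ E) (hSE : S ∈ E) : E = ⊤ := by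
  have hξE : ξ ∈ E := by
    rw [show ξ = (P - 1) / S by rw [hP]; field_simp; ring]
    exact div_mem (sub_mem hPE (one_mem _)) hSE
  have hηE : η ∈ E := by
    rw [show η = (S - 1) / ξ by rw [hS]; field_simp; ring]
    exact div_mem (sub_mem hSE (one_mem _)) hξE
  rw [eq_top_iff, ← hgen, IntermediateField.adjoin_le_iff]
  rintro x (rfl | rfl)
  · exact hξE
  · exact hηE

theorem totalDegree_s_le : s.totalDegree ≤ 2 := by
  refine (totalDegree_add _ _).trans (max_le ((totalDegree_mul _ _).trans ?_) ?_) <;> simp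

theorem totalDegree_p_le : p.totalDegree ≤ 3 := by
  refine (totalDegree_add _ _).trans (max_le ((totalDegree_mul _ _).trans ?_) ?_)
  · rw [totalDegree_X]
    have := totalDegree_s_le
    omega
  · simp

/-- Otherwise p would be a constant c on the curve, but p - c is a nonzero polynomial of degree at
most 3 < 10. -/
theorem transcendental_aeval_p
    (hlow : ∀ b : MvPolynomial (Fin 2) ℂ, b ≠ 0 → b.totalDegree < 10 → aeval ![ξ, η] b ≠ 0) :
    Transcendental ℂ (aeval ![ξ, η] p) := by
  intro h
  obtain ⟨c, hc⟩ := exists_algebraMap_eq_of_isIntegral h.isIntegral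
  refine hlow (p - C c) ?_ ?_ (by rw [map_sub, aeval_C, hc, sub_self])
  · intro h0
    have h1 := congrArg (eval ![0, 0]) h0
    have h2 := congrArg (eval ![1, 0]) h0
    simp [p, s] at h1 h2
    have : (1 : ℂ) = 0 := by linear_combination h2 - h1
    exact one_ne_zero this
  · have := totalDegree_p_le
    refine ((totalDegree_sub _ _).trans (max_le this ?_)).trans_lt (by norm_num : 3 < 10)
    simp

/-- The curve `g' = t`, `t ≠ 0`, is birational to `w² = branchPoly t`. -/
theorem isHyperelliptic_of_isCoprime (hgen : IntermediateField.adjoin ℂ {ξ, η} = ⊤)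
    (h : aeval ![ξ, η] (g' - C t) = 0)
    (hlow : ∀ b : MvPolynomial (Fin 2) ℂ, b ≠ 0 → b.totalDegree < 10 → aeval ![ξ, η] b ≠ 0)
    (hco : IsCoprime (branchPoly t) (Polynomial.derivative (branchPoly t))) :
    ∃ P W : K, IsHyperelliptic P W (branchPoly t) := by
  have : CharZero K := charZero_of_injective_algebraMap (algebraMap ℂ K).injective
  have hξ : ξ ≠ 0 := by simpa using hlow (X 0) (X_ne_zero _) (by simp)
  set P := aeval ![ξ, η] p with hPdef
  set S := aeval ![ξ, η] s with hSdef
  have hS0 : S ≠ 0 := hlow s s_prime.ne_zero (totalDegree_s_le.trans_lt (by norm_num))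
  have hS : S = ξ * η + 1 := by simp [hSdef, s]
  have hP : P = ξ * S + 1 := by simp [hPdef, hSdef, p]
  have htr : Transcendental ℂ P := transcendental_aeval_p hlow
  have hP0 : P ≠ 0 := fun h0 => htr (h0 ▸ isAlgebraic_zero)
  have hrel := relation_of_aeval_eq_zero h hS hP
  have hsq : (18 * P ^ 3 * S - (4 * P - 1) ^ 2) ^ 2 = Polynomial.aeval P (branchPoly t) := by
    simp only [branchPoly, map_add, map_sub, map_mul, map_pow, Polynomial.aeval_X,
      Polynomial.aeval_C, map_one, map_ofNat]
    linear_combination 36 * P ^ 3 * hrel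
  -- Completing the square: W is the derivative in S of the quadratic 9P³S² - (4P - 1)²S - 9t(P -
  -- 1), so W² is its discriminant on the curve, and S is recovered by dividing by 18P³.
  refine ⟨P, 18 * P ^ 3 * S - (4 * P - 1) ^ 2, htr, hsq, ?_, hco, ?_⟩
  · intro h0
    rw [h0, zero_pow two_ne_zero] at hsq
    have hb : branchPoly t = 0 := by
      by_contra hb
      exact htr ⟨_, hb, hsq.symm⟩
    rw [hb, Polynomial.derivative_zero] at hco
    exact not_isCoprime_zero_zero hco
  · have hPE : P ∈ IntermediateField.adjoin ℂ {P, 18 * P ^ 3 * S - (4 * P - 1) ^ 2} :=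
      IntermediateField.subset_adjoin _ _ (by simp)
    have hWE : 18 * P ^ 3 * S - (4 * P - 1) ^ 2 ∈
        IntermediateField.adjoin ℂ {P, 18 * P ^ 3 * S - (4 * P - 1) ^ 2} :=
      IntermediateField.subset_adjoin _ _ (by simp)
    refine adjoin_eq_top_of_mem hgen hS hP hξ hS0 hPE ?_
    have h18 : S = (18 * P ^ 3 * S - (4 * P - 1) ^ 2 + (4 * P - 1) ^ 2) / (18 * P ^ 3) := by
      field_simp
      ring
    have h4 := mul_mem (ofNat_mem (IntermediateField.adjoin ℂ
      {P, 18 * P ^ 3 * S - (4 * P - 1) ^ 2}) 4) hPE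
    have := div_mem (add_mem hWE (pow_mem (sub_mem h4 (one_mem _)) 2))
      (mul_mem (ofNat_mem _ 18) (pow_mem hPE 3))
    rwa [← h18] at this

/-- The curve `g' = 0` is rational. -/
theorem isHyperelliptic_zero (hgen : IntermediateField.adjoin ℂ {ξ, η} = ⊤)
    (h : aeval ![ξ, η] (g' - C 0) = 0)
    (hlow : ∀ b : MvPolynomial (Fin 2) ℂ, b ≠ 0 → b.totalDegree < 10 → aeval ![ξ, η] b ≠ 0) :
    ∃ P : K, IsHyperelliptic P 1 1 := by
  have : CharZero K := charZero_of_injective_algebraMap (algebraMap ℂ K).injective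
  have hξ : ξ ≠ 0 := by simpa using hlow (X 0) (X_ne_zero _) (by simp)
  set P := aeval ![ξ, η] p with hPdef
  set S := aeval ![ξ, η] s with hSdef
  have hS0 : S ≠ 0 := hlow s s_prime.ne_zero (totalDegree_s_le.trans_lt (by norm_num))
  have hS : S = ξ * η + 1 := by simp [hSdef, s]
  have hP : P = ξ * S + 1 := by simp [hPdef, hSdef, p]
  have htr : Transcendental ℂ P := transcendental_aeval_p hlow
  have hP0 : P ≠ 0 := fun h0 => htr (h0 ▸ isAlgebraic_zero)
  have hrel := relation_of_aeval_eq_zero h hS hP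
  have hrel' : 9 * P ^ 3 * S = (4 * P - 1) ^ 2 := by
    apply mul_right_cancel₀ hS0
    rw [map_zero] at hrel
    linear_combination hrel
  -- K = ℂ(P) fits the general framework with w = 1 and q = 1.
  refine ⟨P, htr, by simp, one_ne_zero, isCoprime_one_left, ?_⟩
  have hPE : P ∈ IntermediateField.adjoin ℂ {P, 1} :=
    IntermediateField.subset_adjoin _ _ (by simp)
  refine adjoin_eq_top_of_mem hgen hS hP hξ hS0 hPE ?_
  rw [show S = (4 * P - 1) ^ 2 / (9 * P ^ 3) by rw [← hrel']; field_simp]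
  exact div_mem (pow_mem (sub_mem (mul_mem (ofNat_mem _ 4) hPE) (one_mem _)) 2)
    (mul_mem (ofNat_mem _ 9) (pow_mem hPE 3))

end

/-! ### The genera -/

theorem exists_generators_fiberForm {t : ℂ} (ht : Prime (fiberForm t))
    [(Ideal.span {fiberForm t}).IsPrime] : ∃ ξ η : functionField (fiberForm t),
      IntermediateField.adjoin ℂ {ξ, η} = ⊤ ∧ aeval ![ξ, η] (g' - C t) = 0 ∧
      ∀ b : MvPolynomial (Fin 2) ℂ, b ≠ 0 → b.totalDegree < 10 → aeval ![ξ, η] b ≠ 0 := by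
  rw [← dehomogenize_fiberForm]
  refine exists_generators_functionField (isHomogeneous_fiberForm t) ht.ne_zero fun h => ?_
  exact not_X_two_dvd_fiberForm t ((ht.irreducible.dvd_comm X_two_prime.irreducible).1 h)

theorem hasGeometricGenus_fiberForm_zero : HasGeometricGenus (fiberForm 0) 0 := by
  have hI := (Ideal.span_singleton_prime prime_fiberForm_zero.ne_zero).2 prime_fiberForm_zero
  refine ⟨hI, ?_⟩
  obtain ⟨ξ, η, hgen, h, hlow⟩ := exists_generators_fiberForm prime_fiberForm_zero
  obtain ⟨P, H⟩ := isHyperelliptic_zero hgen h hlow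
  rw [Nat.cast_zero]
  exact H.rank_regularDifferentials_eq_zero two_pos
    (H.reverse (n := 0) (q' := 1) isCoprime_one_left (by simp))

theorem hasGeometricGenus_fiberForm_b' : HasGeometricGenus (fiberForm b') 0 := by
  have hI := (Ideal.span_singleton_prime prime_fiberForm_b'.ne_zero).2 prime_fiberForm_b'
  refine ⟨hI, ?_⟩
  obtain ⟨ξ, η, hgen, h, hlow⟩ := exists_generators_fiberForm prime_fiberForm_b'
  obtain ⟨P, W, H⟩ := isHyperelliptic_of_isCoprime hgen h hlow isCoprime_branchPoly_b'
  rw [Nat.cast_zero]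
  -- q' is the reciprocal polynomial X² q(1/X) of the quadratic `branchPoly b'`, so w/p is the
  -- second coordinate at infinity.
  refine H.rank_regularDifferentials_eq_zero one_lt_two (H.reverse (n := 1)
    (q' := Polynomial.X ^ 2 - 16 * Polynomial.X + 96) ?_ ?_)
  · refine isCoprime_of_eq_const (r := 64) (a := 2) (b := 8 - Polynomial.X) (by norm_num) ?_
    simp only [Polynomial.derivative_add, Polynomial.derivative_sub, Polynomial.derivative_mul,
      Polynomial.derivative_X_pow, Polynomial.derivative_X, Polynomial.derivative_ofNat, map_ofNat,
      Nat.cast_ofNat]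
    ring
  · have hP := H.p_ne_zero
    have hsq := H.sq_eq
    rw [branchPoly_b'] at hsq
    simp only [map_add, map_sub, map_mul, map_pow, Polynomial.aeval_X, map_one, map_ofNat] at hsq ⊢
    field_simp
    linear_combination hsq

theorem hasGeometricGenus_fiberForm_one : HasGeometricGenus (fiberForm 1) 1 := by
  have hI := (Ideal.span_singleton_prime prime_fiberForm_one.ne_zero).2 prime_fiberForm_one
  refine ⟨hI, ?_⟩
  obtain ⟨ξ, η, hgen, h, hlow⟩ := exists_generators_fiberForm prime_fiberForm_one
  obtain ⟨P, W, H⟩ := isHyperelliptic_of_isCoprime hgen h hlow isCoprime_branchPoly_one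
  rw [Nat.cast_one]
  -- q' = X⁴ q(1/X) for the quartic `branchPoly 1`.
  refine H.rank_regularDifferentials_eq_one (H.reverse (n := 2) (q' := Polynomial.X ^ 4 -
    16 * Polynomial.X ^ 3 + 96 * Polynomial.X ^ 2 - 580 * Polynomial.X + 580) ?_ ?_)
  · refine isCoprime_of_eq_const (r := -140940)
      (a := 192 - 48 * Polynomial.X + 4 * Polynomial.X ^ 2)
      (b := 435 - 96 * Polynomial.X + 16 * Polynomial.X ^ 2 - Polynomial.X ^ 3) (by norm_num) ?_
    simp only [Polynomial.derivative_add, Polynomial.derivative_sub, Polynomial.derivative_mul,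
      Polynomial.derivative_X_pow, Polynomial.derivative_X, Polynomial.derivative_ofNat, map_ofNat,
      map_neg, Nat.cast_ofNat]
    ring
  · have hP := H.p_ne_zero
    have hsq := H.sq_eq
    rw [branchPoly_one] at hsq
    simp only [map_add, map_sub, map_mul, map_pow, Polynomial.aeval_X, map_one, map_ofNat] at hsq ⊢
    field_simp
    linear_combination hsq

end PlaneCurve

theorem proposition3p4 :
    (PlaneCurve.HasGeometricGenus (PlaneCurve.C' 1) 1 ∧
      PlaneCurve.HasGeometricGenus (PlaneCurve.C' 0) 0 ∧
      PlaneCurve.HasGeometricGenus (PlaneCurve.C' PlaneCurve.b') 0) ∧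
    (PlaneCurve.IsMPOG (PlaneCurve.C' 1) 10 5 5 6 ∧
      PlaneCurve.HasTotalTjurinaNumber (PlaneCurve.C' 1) 59) ∧
    (PlaneCurve.IsNearlyFree (PlaneCurve.C' 0) 10 5 5 ∧
      PlaneCurve.HasTotalTjurinaNumber (PlaneCurve.C' 0) 60) ∧
    (PlaneCurve.IsNearlyFree (PlaneCurve.C' PlaneCurve.b') 10 5 5 ∧
      PlaneCurve.HasTotalTjurinaNumber (PlaneCurve.C' PlaneCurve.b') 60) := by
  simp only [PlaneCurve.C'_eq_fiberForm]
  exact ⟨⟨PlaneCurve.hasGeometricGenus_fiberForm_one, PlaneCurve.hasGeometricGenus_fiberForm_zero,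
    PlaneCurve.hasGeometricGenus_fiberForm_b'⟩, PlaneCurve.isMPOG_fiberForm_one,
    PlaneCurve.isNearlyFree_fiberForm_zero, PlaneCurve.isNearlyFree_fiberForm_b'⟩
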